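/- Let $d\ge 0$ be an integer and let $\underline a,\overline a$ be symmetric $d\times d$ real matrices with $0\le\underline a\le\overline a$ and $\overline a>0$. Let $\Omega=\{\omega\in C([0,1],\mathbb R^d):\omega(0)=0\}$, let $B$ be the canonical process and $\mathbb F=(\mathcal F_t)_{0\le t\le 1}$ the (non-augmented) filtration it generates. Let $\mathcal P$ be the set of all probability measures $\mathbb P$ on $(\Omega,\mathcal F_1)$ under which $B$ is a martingale whose quadratic variation $\langle B\rangle$ is absolutely continuous and satisfies, for some constant $c=c(\mathbb P)>0$, $$ cI_d\vee\underline a\ \le\ \hat a_t:=\frac{d\langle B\rangle_t}{dt}\ \le\ \overline a\qquad\text{for all }t\in[0,1],\ \mathbb P\text{-a.s.},$$ where $cI_d\vee\underline a$ is obtained from $\underline a$ by replacing each eigenvalue $\lambda$ by $\lambda\vee c$. A property holds quasi-surely if it holds $\mathbb P$-a.s. for every $\mathbb P\in\mathcal P$. For an $\mathbb F$-progressively measurable $\mathbb R^d$-valued process $H$ and a real-valued process $Y$ put $$\|H\|_{\mathbb H^2_{\mathcal P}}=\sup_{\mathbb P\in\mathcal P}\Big(\mathbb E^{\mathbb P}\Big[\int_0^1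 \hat a_tH_t\cdot H_t\,dt\Big]\Big)^{1/2},\qquad \|Y\|_{\mathbb S^2_{\mathcal P}}=\sup_{\mathbb P\in\mathcal P}\Big(\mathbb E^{\mathbb P}\Big[\operatorname*{ess\,sup}_{0\le t\le1}|Y_t|^2\Big]\Big)^{1/2}.$$ Let $G(\gamma)=\frac12\sup\{\operatorname{tr}(\gamma a):\underline a\le a\le\overline a\}$. Let $\mathcal L_{ip}$ be the set of all $\xi=\varphi(B_{t_1},\dots,B_{t_n})$ with $0\le t_1\le\dots\le t_n\le 1$ and $\varphi$ bounded and Lipschitz. For such $\xi$ the $G$-expectation is $\mathbb E^G[\xi]=v_1(0,0)$. Here, with $t_0=0$ and for $i=n,\dots,1$, $v_i(\cdot,x_1,\dots,x_{i-1},\cdot)$ is the bounded, continuous, spatially Lipschitz viscosity solution of $-\partial_tv_i-G(D^2v_i)=0$ on $[t_{i-1},t_i)\times\mathbb R^d$ with terminal value $v_i(t_i,x_1,\dots,x_{i-1},x)=v_{i+1}(t_i,x_1,\dots,x_{i-1},x,x)$ for $i<n$ and $v_n(t_n,x_1,\dots,x_{n-1},x)=\varphi(x_1,\dots,x_{n-1},x)$;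 a constant has $G$-expectation equal to itself. Let $\mathcal L^2_G$ be the closure of $\mathcal L_{ip}$ under the norm $(\mathbb E^G[|\xi|^2])^{1/2}$, realized as random variables: $\xi\in\mathcal L^2_G$ if $\xi$ is $\mathcal F_1$-measurable and some sequence in $\mathcal L_{ip}$ that is Cauchy for this norm converges to $\xi$ in $L^2(\mathbb P)$ for every $\mathbb P\in\mathcal P$. Let $\mathcal H^{2,0}_G$ be the set of processes $H=\sum_{i=0}^{n-1}H_{t_i}\mathbf 1_{[t_i,t_{i+1})}$ with $0=t_0\le\dots\le t_n=1$ and $H_{t_i}$ an $\mathcal F_{t_i}$-measurable $\mathbb R^d$-valued random variable with all coordinates in $\mathcal L^2_G$. Let $\mathcal H^2_{\mathcal P}$ be the closure of $\mathcal H^{2,0}_G$ under $\|\cdot\|_{\mathbb H^2_{\mathcal P}}$ in the space of $\mathbb F$-progressively measurable $\mathbb R^d$-valued processes of finite $\|\cdot\|_{\mathbb H^2_{\mathcal P}}$-norm. **Theorem.** For every $H\in\mathcal H^2_{\mathcal P}$ the stochastic integral $\int_0^\cdot H_s\,dB_s$ exists quasi-surely. That is, there is one $\mathbb F$-progressively measurable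 process $M$, with quasi-surely continuous paths and $\|M\|_{\mathbb S^2_{\mathcal P}}<\infty$, which for every $\mathbb P\in\mathcal P$ is a version of the Itô integral of $H$ with respect to $B$ under $\mathbb P$ and is $\mathbb P$-indistinguishable from every continuous version of that Itô integral. Moreover, writing $\int_0^\cdot H_s\,dB_s:=M$, $$\|H\|_{\mathbb H^2_{\mathcal P}}\ \le\ \Big\|\int_0^\cdot H_s\,dB_s\Big\|_{\mathbb S^2_{\mathcal P}}\ \le\ 2\,\|H\|_{\mathbb H^2_{\mathcal P}} .$$ -/

import Mathlib

open MeasureTheory Filter Topology Set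
open scoped ENNReal NNReal unitInterval

noncomputable section

namespace QuasiSure

/-! ### Canonical space -/

/-- The state space `ℝ^d`. -/
abbrev Vec (d : ℕ) : Type := EuclideanSpace ℝ (Fin d)

/-- The canonical space of continuous paths `[0,1] → ℝ^d` starting at `0`. -/
def PathSpace (d : ℕ) : Type := {w : C(I, Vec d) // w 0 = 0}

/-- The canonical process. -/
def B {d : ℕ} (t : I) (ω : PathSpace d) : Vec d := ω.1 t

/-- The σ-algebra generated by the canonical process. -/
instance instMeasurableSpacePathSpace (d : ℕ) : MeasurableSpace (PathSpace d) :=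
  ⨆ t : I, MeasurableSpace.comap (B t) inferInstance

theorem measurable_B {d : ℕ} (t : I) : Measurable (B (d := d) t) :=
  Measurable.of_comap_le (le_iSup (fun t : I => MeasurableSpace.comap (B (d := d) t) _) t)

/-- The raw (neither augmented nor right-continuous) filtration generated by the canonical
process. -/
def canonFiltration (d : ℕ) : Filtration I (instMeasurableSpacePathSpace d) :=
  Filtration.natural (fun t => B (d := d) t) (fun t => (measurable_B t).stronglyMeasurable)

/-! ### Volatility bounds and the class of measures -/

/-- `A ∨ c I_d`: the matrix with the eigenvectors of the symmetric matrix `A`, each eigenvalue `λ`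
being replaced by `max λ c`. -/
def supScalar {d : ℕ} {A : Matrix (Fin d) (Fin d) ℝ} (hA : A.IsHermitian) (c : ℝ) :
    Matrix (Fin d) (Fin d) ℝ :=
  hA.cfc (fun l => max l c)

/-- `a` is (a progressively measurable version of) the density `d⟨B⟩_t / dt` of the quadratic
variation of the canonical process under `P`: it takes values in the positive semidefinite
matrices, and `B^i B^j - ∫_0^· a^{ij}_s ds` is a `P`-martingale for all `i, j`. -/
structure IsQVDensity {d : ℕ} (P : Measure (PathSpace d))
    (a : I → PathSpace d → Matrix (Fin d) (Fin d) ℝ) : Prop where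
  progressive : ∀ i j, IsStronglyProgressive (canonFiltration d) (fun t ω => a t ω i j)
  posSemidef : ∀ t ω, (a t ω).PosSemidef
  integrable : ∀ i j, Integrable (fun q : I × PathSpace d => a q.1 q.2 i j) (volume.prod P)
  martingale : ∀ i j, Martingale
    (fun t ω => B t ω i * B t ω j - ∫ s in Iic t, a s ω i j) (canonFiltration d) P

/-- The class `𝒫` of probability measures under which the canonical process is a martingale with
`c I_d ∨ aLow ≤ d⟨B⟩_t/dt ≤ aUp` almost surely, for some constant `c > 0` depending on the
measure. -/
def measureClass {d : ℕ} {aLow : Matrix (Fin d) (Fin d) ℝ} (hLow : aLow.IsHermitian)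
    (aUp : Matrix (Fin d) (Fin d) ℝ) : Set (Measure (PathSpace d)) :=
  {P | IsProbabilityMeasure P ∧ Martingale (fun t => B (d := d) t) (canonFiltration d) P ∧
    ∃ a, IsQVDensity P a ∧ ∃ c : ℝ, 0 < c ∧ ∀ᵐ ω ∂P, ∀ t : I,
      (a t ω - supScalar hLow c).PosSemidef ∧ (aUp - a t ω).PosSemidef}

open Classical in
/-- The density `d⟨B⟩_t / dt` under `P`. It is unique up to `dt × dP`-null sets; one version is
chosen. -/
def qvDensity {d : ℕ} (P : Measure (PathSpace d)) :
    I → PathSpace d → Matrix (Fin d) (Fin d) ℝ :=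
  if h : ∃ a, IsQVDensity P a then h.choose else 0

/-- `∫_0^1 d⟨B⟩_t H_t · H_t` under `P`. -/
def energy {d : ℕ} (P : Measure (PathSpace d)) (H : I → PathSpace d → Vec d)
    (ω : PathSpace d) : ℝ≥0∞ :=
  ∫⁻ t : I, ENNReal.ofReal (H t ω ⬝ᵥ (qvDensity P t ω).mulVec (H t ω))

/-! ### Norms (with exponent `2`) -/

/-- The norm `‖H‖ = sup_P (E^P ∫_0^1 d⟨B⟩_t H_t · H_t)^{1/2}` of an integrand. -/
def hNorm {d : ℕ} (Pc : Set (Measure (PathSpace d))) (H : I → PathSpace d → Vec d) : ℝ≥0∞ :=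
  (⨆ P ∈ Pc, ∫⁻ ω, energy P H ω ∂P) ^ (1 / 2 : ℝ)

/-- The norm `‖Y‖ = sup_P (E^P ess sup_t |Y_t|²)^{1/2}` of a process. -/
def sNorm {d : ℕ} (Pc : Set (Measure (PathSpace d))) (Y : I → PathSpace d → ℝ) : ℝ≥0∞ :=
  (⨆ P ∈ Pc, ∫⁻ ω, essSup (fun t : I => ‖Y t ω‖ₑ ^ 2) volume ∂P) ^ (1 / 2 : ℝ)

/-- `𝕊²`: progressively measurable processes with quasi-surely continuous paths and finite
norm. -/
structure MemS2 {d : ℕ} (Pc : Set (Measure (PathSpace d))) (Y : I → PathSpace d → ℝ) : Prop where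
  progressive : IsStronglyProgressive (canonFiltration d) Y
  continuous : ∀ P ∈ Pc, ∀ᵐ ω ∂P, Continuous (fun t => Y t ω)
  finite : sNorm Pc Y < ∞

/-! ### The `G`-expectation through viscosity solutions of the nonlinear heat equation -/

/-- `G(γ) = ½ sup {tr(γ a) : aLow ≤ a ≤ aUp}`. -/
def G {d : ℕ} (aLow aUp : Matrix (Fin d) (Fin d) ℝ) (γ : Matrix (Fin d) (Fin d) ℝ) : ℝ :=
  (1 / 2) * sSup ((fun a => (γ * a).trace) '' {a | (a - aLow).PosSemidef ∧ (aUp - a).PosSemidef})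

/-- The Hessian of a function on `ℝ^d`, as a matrix of second derivatives. -/
def hessian {d : ℕ} (f : Vec d → ℝ) (x : Vec d) : Matrix (Fin d) (Fin d) ℝ :=
  Matrix.of fun i j =>
    iteratedFDeriv ℝ 2 f x ![EuclideanSpace.single i 1, EuclideanSpace.single j 1]

/-- `-∂_t ψ - G(D²ψ)` at `(t, x)`. -/
def heatOp {d : ℕ} (aLow aUp : Matrix (Fin d) (Fin d) ℝ) (ψ : ℝ × Vec d → ℝ)
    (t : ℝ) (x : Vec d) : ℝ :=
  -deriv (fun τ => ψ (τ, x)) t - G aLow aUp (hessian (fun y => ψ (t, y)) x)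

/-- `u` is the bounded, (spatially) Lipschitz, continuous viscosity solution of
`-∂_t u - G(D²u) = 0` on `[s, T) × ℝ^d` with terminal value `u(T, ·) = f`. -/
structure IsViscositySolution {d : ℕ} (aLow aUp : Matrix (Fin d) (Fin d) ℝ) (s T : ℝ)
    (u : ℝ → Vec d → ℝ) (f : Vec d → ℝ) : Prop where
  continuousOn : ContinuousOn (fun q : ℝ × Vec d => u q.1 q.2) (Icc s T ×ˢ univ)
  bounded : ∃ C : ℝ, ∀ t ∈ Icc s T, ∀ x, |u t x| ≤ C
  lipschitz : ∃ K : ℝ≥0, ∀ t ∈ Icc s T, LipschitzWith K (u t)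
  terminal : u T = f
  subsolution : ∀ ψ : ℝ × Vec d → ℝ, ContDiff ℝ 2 ψ → ∀ t ∈ Ico s T, ∀ x,
    IsLocalMaxOn (fun q : ℝ × Vec d => u q.1 q.2 - ψ q) (Ico s T ×ˢ univ) (t, x) →
      heatOp aLow aUp ψ t x ≤ 0
  supersolution : ∀ ψ : ℝ × Vec d → ℝ, ContDiff ℝ 2 ψ → ∀ t ∈ Ico s T, ∀ x,
    IsLocalMinOn (fun q : ℝ × Vec d => u q.1 q.2 - ψ q) (Ico s T ×ˢ univ) (t, x) →
      0 ≤ heatOp aLow aUp ψ t x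

/-- The cylindrical random variable `φ(B_{t_1}, …, B_{t_n})`. -/
def cylVar {d n : ℕ} (t : Fin n → I) (φ : (Fin n → Vec d) → ℝ) : PathSpace d → ℝ :=
  fun ω => φ (fun i => B (t i) ω)

/-- `ξ = φ(B_{t_1}, …, B_{t_n})` with `φ` bounded and Lipschitz and
`0 ≤ t_1 ≤ … ≤ t_n ≤ 1`. -/
def IsCylinder {d n : ℕ} (ξ : PathSpace d → ℝ) (t : Fin n → I) (φ : (Fin n → Vec d) → ℝ) : Prop :=
  Monotone t ∧ (∃ C : ℝ, ∀ x, |φ x| ≤ C) ∧ (∃ K : ℝ≥0, LipschitzWith K φ) ∧ ξ = cylVar t φ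

/-- The space `ℒ_ip` of bounded Lipschitz cylindrical random variables. -/
def MemLip {d : ℕ} (ξ : PathSpace d → ℝ) : Prop :=
  ∃ (n : ℕ) (t : Fin n → I) (φ : (Fin n → Vec d) → ℝ), IsCylinder ξ t φ

/-- The time `t_i` preceding the `i`-th interval, where `t_0 = 0` (the entry `t i` of the tuple is
the point `t_{i+1}`). -/
def prevTime {n : ℕ} (t : Fin n → I) (i : Fin n) : ℝ :=
  if h : i.1 = 0 then 0 else (t ⟨i.1 - 1, by omega⟩ : ℝ)

/-- `E^G[ξ] = e` for `ξ ∈ ℒ_ip`. The value is computed by backward recursion: `v n` is `φ`, and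
for `i < n` the function `v i x (·, ·)`, with the values of `B` at the earlier time points as
parameters in `x`, solves the nonlinear heat equation on the `i`-th time interval, with the terminal
value obtained from `v (i+1)` by substituting the current state for the `i`-th coordinate; finally
`e` is the value of the first function at time `0` and state `0`. -/
def HasGExpectation {d : ℕ} (aLow aUp : Matrix (Fin d) (Fin d) ℝ) (ξ : PathSpace d → ℝ)
    (e : ℝ) : Prop :=
  ∃ (n : ℕ) (t : Fin n → I) (φ : (Fin n → Vec d) → ℝ), IsCylinder ξ t φ ∧
    ∃ v : ℕ → (Fin n → Vec d) → ℝ → Vec d → ℝ,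
      (∀ x τ y, v n x τ y = φ x) ∧
      (∀ (i : Fin n) (x : Fin n → Vec d),
        IsViscositySolution aLow aUp (prevTime t i) (t i) (v i x)
          (fun y => v (i + 1) (Function.update x i y) (t i) y)) ∧
      ∀ x, v 0 x 0 0 = e

/-- `ξ ∈ ℒ²_G`, the closure of `ℒ_ip` under the norm `E^G[|ξ|²]^{1/2}`, realized as a space of
random variables: `ξ` is the limit, in `L²(P)` for every `P` in the class, of a sequence in `ℒ_ip`
which is Cauchy for this norm. -/
def MemL2G {d : ℕ} {aLow : Matrix (Fin d) (Fin d) ℝ} (hLow : aLow.IsHermitian)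
    (aUp : Matrix (Fin d) (Fin d) ℝ) (ξ : PathSpace d → ℝ) : Prop :=
  Measurable ξ ∧ ∃ ζ : ℕ → PathSpace d → ℝ, (∀ k, MemLip (ζ k)) ∧
    (∀ ε : ℝ, 0 < ε → ∃ N : ℕ, ∀ k ≥ N, ∀ l ≥ N,
      ∃ e ≤ ε, HasGExpectation aLow aUp (fun ω => |ζ k ω - ζ l ω| ^ 2) e) ∧
    ∀ P ∈ measureClass hLow aUp,
      Tendsto (fun k => eLpNorm (fun ω => ζ k ω - ξ ω) 2 P) atTop (𝓝 0)

/-! ### Simple integrands and their integrals -/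

/-- A piecewise constant adapted integrand `∑_{i < n} H_{t_i} 1_{[t_i, t_{i+1})}` with
`0 = t_0 ≤ t_1 ≤ … ≤ t_n = 1` and `H_{t_i}` being `ℱ_{t_i}`-measurable. -/
structure SimpleIntegrand (d : ℕ) where
  n : ℕ
  time : Fin (n + 1) → I
  time_mono : Monotone time
  time_zero : time 0 = 0
  time_last : time (Fin.last n) = 1
  val : Fin n → PathSpace d → Vec d
  val_measurable : ∀ i : Fin n, Measurable[canonFiltration d (time i.castSucc)] (val i)

/-- The process `H_s = ∑_i H_{t_i} 1_{[t_i, t_{i+1})}(s)`. -/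
def SimpleIntegrand.process {d : ℕ} (H : SimpleIntegrand d) (s : I) (ω : PathSpace d) : Vec d :=
  ∑ i : Fin H.n, (Ico (H.time i.castSucc) (H.time i.succ)).indicator (fun _ => H.val i ω) s

/-- The pathwise integral `∑_i H_{t_i} · (B_{s ∧ t_{i+1}} - B_{s ∧ t_i})`. -/
def SimpleIntegrand.integral {d : ℕ} (H : SimpleIntegrand d) (s : I) (ω : PathSpace d) : ℝ :=
  ∑ i : Fin H.n, inner ℝ (H.val i ω) (B (min s (H.time i.succ)) ω - B (min s (H.time i.castSucc)) ω)

/-- `ℋ^{2,0}_G`: the simple integrands whose values have all coordinates in `ℒ²_G`. -/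
def MemH20G {d : ℕ} {aLow : Matrix (Fin d) (Fin d) ℝ} (hLow : aLow.IsHermitian)
    (aUp : Matrix (Fin d) (Fin d) ℝ) (H : SimpleIntegrand d) : Prop :=
  ∀ (i : Fin H.n) (j : Fin d), MemL2G hLow aUp (fun ω => H.val i ω j)

/-- `ℋ²_𝒫`: the closure of `ℋ^{2,0}_G`, in the space of progressively measurable integrands of
finite norm, under the norm `hNorm`. -/
structure MemH2 {d : ℕ} {aLow : Matrix (Fin d) (Fin d) ℝ} (hLow : aLow.IsHermitian)
    (aUp : Matrix (Fin d) (Fin d) ℝ) (H : I → PathSpace d → Vec d) : Prop where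
  progressive : IsStronglyProgressive (canonFiltration d) H
  finite : hNorm (measureClass hLow aUp) H < ∞
  approx : ∃ K : ℕ → SimpleIntegrand d, (∀ k, MemH20G hLow aUp (K k)) ∧
    Tendsto (fun k => hNorm (measureClass hLow aUp) (fun t ω => (K k).process t ω - H t ω))
      atTop (𝓝 0)

/-! ### The Itô integral under one measure -/

/-- `M` is (a version of) the Itô integral `∫_0^· H_s dB_s` under `P`: it has `P`-almost surely
continuous paths and is the `L²(P)`-limit, at every time, of the integrals of bounded simple
integrands `K k` with `E^P ∫_0^1 d⟨B⟩_t (K k_t - H_t) · (K k_t - H_t) → 0`. -/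
def IsItoIntegral {d : ℕ} (P : Measure (PathSpace d)) (H : I → PathSpace d → Vec d)
    (M : I → PathSpace d → ℝ) : Prop :=
  (∀ t, AEStronglyMeasurable (M t) P) ∧ (∀ᵐ ω ∂P, Continuous (fun t => M t ω)) ∧
    ∃ K : ℕ → SimpleIntegrand d,
      (∀ k, ∃ C : ℝ, ∀ i ω, ‖(K k).val i ω‖ ≤ C) ∧
      Tendsto (fun k => ∫⁻ ω, energy P (fun t ω => (K k).process t ω - H t ω) ω ∂P) atTop (𝓝 0) ∧
      ∀ t, Tendsto (fun k => eLpNorm (fun ω => (K k).integral t ω - M t ω) 2 P) atTop (𝓝 0)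

end QuasiSure

end

/-! The difficulty is that one process must serve for all measures of the class, which in general
have no common dominating measure. The integral of a simple integrand is a finite sum formed path by
path, so it involves no measure. Since `hNorm` is a supremum over the class, a single subsequence of
simple approximants can be chosen whose error is at most `2⁻¹ ^ j` under every `P` at once. The
pointwise limit of their integrals, `limitIntegral`, is again defined without a measure and is
progressive for the raw filtration.

Under one fixed `P` the argument is classical `L²` theory. The martingale properties of `B` and of
`B^i B^j - ∫ a^{ij}` give the polarized Itô isometry for bounded simple integrands
(`IsBounded.integral_mul_integral`). Doob's inequality, proved along finite grids and carried to
continuous paths by Fatou, turns it into a bound on the supremum of the difference of two integrals;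
truncation removes the boundedness. Geometric errors are summable, so almost every path converges
uniformly and the limit is continuous (`ae_tendsto_and_continuous`). The isometry and Doob's bound
pass to the limit, and they also force any other version of the integral to agree with it
(`indistinguishable`).

Both norm inequalities hold for each `P` and survive the supremum. The upper one is Doob's
inequality, whose constant `4` becomes `2` under the square root. The lower one is the isometry at
time `1`, together with the fact that a continuous path is bounded at time `1` by its essential
supremum. -/

noncomputable section

namespace QuasiSure

/-! ### Square integrable martingales and Doob's inequality -/

section L2Martingale

variable {Ω ι : Type*} {m : MeasurableSpace Ω} [Preorder ι]

/-- A square integrable martingale: adapted, with increments orthogonal to the square integrable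
random variables of the past. -/
structure IsL2Martingale (ℱ : Filtration ι m) (μ : Measure Ω) (X : ι → Ω → ℝ) : Prop where
  adapted : ∀ t, StronglyMeasurable[ℱ t] (X t)
  memLp : ∀ t, MemLp (X t) 2 μ
  orthogonal : ∀ s t, s ≤ t → ∀ Z : Ω → ℝ, StronglyMeasurable[ℱ s] Z → MemLp Z 2 μ →
    ∫ ω, Z ω * (X t ω - X s ω) ∂μ = 0

theorem memLp_two_mul_integrable {μ : Measure Ω} {f g : Ω → ℝ} (hf : MemLp f 2 μ)
    (hg : MemLp g 2 μ) : Integrable (fun ω => f ω * g ω) μ :=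
  MemLp.integrable_mul hf hg

/-- The increments of a martingale are orthogonal to the past. -/
theorem integral_mul_martingale_sub {ℱ : Filtration ι m} {μ : Measure Ω} [IsFiniteMeasure μ]
    {X : ι → Ω → ℝ} (hX : Martingale X ℱ μ) {s t : ι} (hst : s ≤ t) {Z : Ω → ℝ}
    (hZ : StronglyMeasurable[ℱ s] Z) (hs : Integrable (fun ω => Z ω * X s ω) μ)
    (ht : Integrable (fun ω => Z ω * X t ω) μ) : ∫ ω, Z ω * (X t ω - X s ω) ∂μ = 0 := by
  have h1 : μ[fun ω => Z ω * X t ω | ℱ s] =ᵐ[μ] fun ω => Z ω * X s ω := by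
    have h2 := condExp_mul_of_stronglyMeasurable_left (m := ℱ s) hZ (g := X t) ht
      (hX.integrable t)
    filter_upwards [h2, hX.condExp_ae_eq hst] with ω e1 e2
    have e1' : (μ[fun ω => Z ω * X t ω | ℱ s]) ω = Z ω * (μ[X t | ℱ s]) ω := e1
    rw [e1', e2]
  have h3 : ∫ ω, Z ω * X t ω ∂μ = ∫ ω, Z ω * X s ω ∂μ := by
    rw [← integral_condExp (ℱ.le s)]
    exact integral_congr_ae h1
  simp_rw [mul_sub]
  rw [integral_sub ht hs, h3, sub_self]

theorem _root_.MeasureTheory.Martingale.isL2Martingale {ℱ : Filtration ι m} {μ : Measure Ω}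
    [IsFiniteMeasure μ] {X : ι → Ω → ℝ} (hX : Martingale X ℱ μ) (h2 : ∀ t, MemLp (X t) 2 μ) :
    IsL2Martingale ℱ μ X where
  adapted := hX.stronglyAdapted
  memLp := h2
  orthogonal s t hst _ hZ hZ2 := integral_mul_martingale_sub hX hst hZ
    (memLp_two_mul_integrable hZ2 (h2 s)) (memLp_two_mul_integrable hZ2 (h2 t))

namespace IsL2Martingale

variable {ℱ : Filtration ι m} {μ : Measure Ω} {X Y : ι → Ω → ℝ}

theorem sub (hX : IsL2Martingale ℱ μ X) (hY : IsL2Martingale ℱ μ Y) :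
    IsL2Martingale ℱ μ (fun t ω => X t ω - Y t ω) where
  adapted t := (hX.adapted t).sub (hY.adapted t)
  memLp t := (hX.memLp t).sub (hY.memLp t)
  orthogonal s t hst Z hZ hZ2 := by
    have h1 := hX.orthogonal s t hst Z hZ hZ2
    have h2 := hY.orthogonal s t hst Z hZ hZ2
    have i1 : Integrable (fun ω => Z ω * (X t ω - X s ω)) μ :=
      memLp_two_mul_integrable hZ2 ((hX.memLp t).sub (hX.memLp s))
    have i2 : Integrable (fun ω => Z ω * (Y t ω - Y s ω)) μ :=
      memLp_two_mul_integrable hZ2 ((hY.memLp t).sub (hY.memLp s))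
    calc ∫ ω, Z ω * (X t ω - Y t ω - (X s ω - Y s ω)) ∂μ
        = ∫ ω, (Z ω * (X t ω - X s ω) - Z ω * (Y t ω - Y s ω)) ∂μ := by
          congr 1; ext ω; ring
      _ = 0 := by
          rw [integral_sub i1 i2, h1, h2, sub_zero]

theorem sum {κ : Type*} (S : Finset κ) {X : κ → ι → Ω → ℝ}
    (hX : ∀ k ∈ S, IsL2Martingale ℱ μ (X k)) :
    IsL2Martingale ℱ μ (fun t ω => ∑ k ∈ S, X k t ω) where
  adapted t := Finset.stronglyMeasurable_fun_sum S fun k hk => (hX k hk).adapted t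
  memLp t := memLp_finsetSum S fun k hk => (hX k hk).memLp t
  orthogonal s t hst Z hZ hZ2 := by
    simp_rw [← Finset.sum_sub_distrib, Finset.mul_sum]
    rw [integral_finsetSum]
    · exact Finset.sum_eq_zero fun k hk => (hX k hk).orthogonal s t hst Z hZ hZ2
    · exact fun k hk => memLp_two_mul_integrable hZ2 (((hX k hk).memLp t).sub ((hX k hk).memLp s))

theorem comp_mono {κ : Type*} [Preorder κ] (hX : IsL2Martingale ℱ μ X) {τ : κ → ι}
    (hτ : Monotone τ) :
    IsL2Martingale (⟨fun k => ℱ (τ k), fun _ _ h => ℱ.mono (hτ h), fun _ => ℱ.le _⟩ :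
      Filtration κ m) μ (fun k => X (τ k)) where
  adapted k := hX.adapted (τ k)
  memLp k := hX.memLp (τ k)
  orthogonal s t hst := hX.orthogonal (τ s) (τ t) (hτ hst)

end IsL2Martingale

/-- The running maximum of the absolute value of a sequence. -/
def runMax (X : ℕ → Ω → ℝ) : ℕ → Ω → ℝ
  | 0 => fun ω => |X 0 ω|
  | n + 1 => fun ω => max (runMax X n ω) |X (n + 1) ω|

theorem runMax_nonneg (X : ℕ → Ω → ℝ) (n : ℕ) (ω : Ω) : 0 ≤ runMax X n ω := by
  cases n with
  | zero => exact abs_nonneg _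
  | succ n => exact le_max_of_le_right (abs_nonneg _)

theorem abs_le_runMax (X : ℕ → Ω → ℝ) {k n : ℕ} (h : k ≤ n) (ω : Ω) : |X k ω| ≤ runMax X n ω := by
  induction n with
  | zero => obtain rfl : k = 0 := by omega
            exact le_rfl
  | succ n ih =>
    rcases Nat.lt_or_ge n k with h' | h'
    · obtain rfl : k = n + 1 := by omega
      exact le_max_right _ _
    · exact (ih h').trans (le_max_left _ _)

variable {𝒢 : Filtration ℕ m} {μ : Measure Ω} {X : ℕ → Ω → ℝ}

theorem IsL2Martingale.runMax_stronglyMeasurable (hX : IsL2Martingale 𝒢 μ X) (n : ℕ) :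
    StronglyMeasurable[𝒢 n] (runMax X n) := by
  induction n with
  | zero => exact (hX.adapted 0).norm
  | succ n ih =>
    have h1 : StronglyMeasurable[𝒢 (n + 1)] (runMax X n) := ih.mono (𝒢.mono n.le_succ)
    exact @StronglyMeasurable.sup _ _ _ _ (𝒢 (n + 1)) _ _ _ h1 (hX.adapted (n + 1)).norm

theorem IsL2Martingale.runMax_memLp (hX : IsL2Martingale 𝒢 μ X) (n : ℕ) :
    MemLp (runMax X n) 2 μ := by
  induction n with
  | zero => exact (hX.memLp 0).norm
  | succ n ih => exact ih.sup (hX.memLp (n + 1)).norm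

/-- Writing `A n` for the running maximum, the expectation of `A n * |X n| - A n ^ 2 / 2` does not
decrease in `n`. Replacing `|X n|` by the smaller tangent at `X n` of `|X (n + 1)|` costs nothing by
orthogonality; when the maximum jumps from `A` to `b`, the gain is `(b - A) ^ 2 / 2`. -/
theorem IsL2Martingale.half_runMax_sq_le (hX : IsL2Martingale 𝒢 μ X) (n : ℕ) :
    0 ≤ ∫ ω, (runMax X n ω * |X n ω| - runMax X n ω * runMax X n ω / 2) ∂μ := by
  induction n with
  | zero =>
    refine integral_nonneg fun ω => ?_
    simp only [runMax, Pi.zero_apply]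
    nlinarith [mul_self_nonneg |X 0 ω|]
  | succ n ih =>
    have hint : ∀ n, Integrable
        (fun ω => runMax X n ω * |X n ω| - runMax X n ω * runMax X n ω / 2) μ := fun n =>
      (memLp_two_mul_integrable (hX.runMax_memLp n) (hX.memLp n).norm).sub
        ((memLp_two_mul_integrable (hX.runMax_memLp n) (hX.runMax_memLp n)).div_const 2)
    -- The running maximum times the sign of `X n`, with sign `1` at zero: a weight known at time
    -- `n`.
    set Z : Ω → ℝ := fun ω => runMax X n ω * (if 0 ≤ X n ω then 1 else -1) with hZ
    have hZm : StronglyMeasurable[𝒢 n] Z := by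
      refine (hX.runMax_stronglyMeasurable n).mul ?_
      refine StronglyMeasurable.ite ?_ stronglyMeasurable_const stronglyMeasurable_const
      exact (hX.adapted n).measurable measurableSet_Ici
    have hZ2 : MemLp Z 2 μ := by
      refine (hX.runMax_memLp n).of_le (hZm.mono (𝒢.le n)).aestronglyMeasurable
        (Eventually.of_forall fun ω => ?_)
      rw [hZ]
      simp only [norm_mul]
      split_ifs <;> simp
    have h0 := hX.orthogonal n (n + 1) n.le_succ Z hZm hZ2
    have hZi : Integrable (fun ω => Z ω * (X (n + 1) ω - X n ω)) μ :=
      memLp_two_mul_integrable hZ2 ((hX.memLp (n + 1)).sub (hX.memLp n))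
    have h1 := integral_add (hint n) hZi
    rw [h0, add_zero] at h1
    refine (ih.trans h1.ge).trans (integral_mono ((hint n).add hZi) (hint (n + 1)) fun ω => ?_)
    simp only [hZ, runMax]
    have hA := runMax_nonneg X n ω
    have key : |X n ω| + (if 0 ≤ X n ω then 1 else -1) * (X (n + 1) ω - X n ω)
        ≤ |X (n + 1) ω| := by
      split_ifs with h
      · rw [abs_of_nonneg h]; linarith [le_abs_self (X (n + 1) ω)]
      · rw [abs_of_neg (not_le.mp h)]; linarith [neg_abs_le (X (n + 1) ω)]
    have key2 := mul_le_mul_of_nonneg_left key hA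
    rcases le_total |X (n + 1) ω| (runMax X n ω) with h | h
    · rw [max_eq_left h]; linarith
    · rw [max_eq_right h]; nlinarith [sq_nonneg (|X (n + 1) ω| - runMax X n ω)]

/-- **Doob's inequality** in `L²`. -/
theorem IsL2Martingale.integral_runMax_sq_le (hX : IsL2Martingale 𝒢 μ X) (n : ℕ) :
    ∫ ω, runMax X n ω ^ 2 ∂μ ≤ 4 * ∫ ω, X n ω ^ 2 ∂μ := by
  have h := hX.half_runMax_sq_le n
  have i1 := memLp_two_mul_integrable (hX.runMax_memLp n) (hX.memLp n).norm
  have i2 : Integrable (fun ω => runMax X n ω ^ 2) μ := (hX.runMax_memLp n).integrable_sq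
  have i3 : Integrable (fun ω => X n ω ^ 2) μ := (hX.memLp n).integrable_sq
  have h1 : ∫ ω, (runMax X n ω * |X n ω| - runMax X n ω * runMax X n ω / 2) ∂μ
      ≤ ∫ ω, (X n ω ^ 2 - runMax X n ω ^ 2 / 4) ∂μ := by
    refine integral_mono ?_ (i3.sub (i2.div_const 4)) fun ω => ?_
    · exact i1.sub ((memLp_two_mul_integrable (hX.runMax_memLp n) (hX.runMax_memLp n)).div_const 2)
    · simp only
      rw [← sq_abs (X n ω)]
      -- Completing this square gives `A |X| ≤ X ^ 2 + A ^ 2 / 4`, hence the constant `4`.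
      nlinarith [sq_nonneg (|X n ω| - runMax X n ω / 2)]
  rw [integral_sub i3 (i2.div_const 4), integral_div] at h1
  linarith

theorem IsL2Martingale.lintegral_runMax_sq_le (hX : IsL2Martingale 𝒢 μ X) (n : ℕ) :
    ∫⁻ ω, ‖runMax X n ω‖ₑ ^ 2 ∂μ ≤ 4 * ∫⁻ ω, ‖X n ω‖ₑ ^ 2 ∂μ := by
  have e : ∀ f : Ω → ℝ, MemLp f 2 μ →
      ∫⁻ ω, ‖f ω‖ₑ ^ 2 ∂μ = ENNReal.ofReal (∫ ω, f ω ^ 2 ∂μ) := by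
    intro f hf
    rw [ofReal_integral_eq_lintegral_ofReal hf.integrable_sq
      (Eventually.of_forall fun ω => sq_nonneg _)]
    refine lintegral_congr fun ω => ?_
    rw [← sq_abs, ENNReal.ofReal_pow (abs_nonneg _), Real.enorm_eq_ofReal_abs]
  rw [e _ (hX.runMax_memLp n), e _ (hX.memLp n), ← ENNReal.ofReal_ofNat 4,
    ← ENNReal.ofReal_mul (by norm_num)]
  exact ENNReal.ofReal_le_ofReal (hX.integral_runMax_sq_le n)

end L2Martingale

/-! ### Doob's inequality in continuous time, along uniform grids. -/

/-- The `i`-th point of the uniform grid with `n + 1` cells. -/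
def gridPoint (n i : ℕ) : I := projIcc 0 1 zero_le_one ((i : ℝ) / ((n : ℝ) + 1))

theorem gridPoint_mono (n : ℕ) : Monotone (gridPoint n) := fun _ _ h =>
  monotone_projIcc _ (by gcongr)

theorem gridPoint_last (n : ℕ) : gridPoint n (n + 1) = 1 := by
  have h : ((n : ℝ) + 1) ≠ 0 := by positivity
  simp [gridPoint, div_self h]

theorem exists_gridPoint_tendsto (t : I) :
    ∃ i : ℕ → ℕ, (∀ n, i n ≤ n + 1) ∧ Tendsto (fun n => gridPoint n (i n)) atTop (𝓝 t) := by
  refine ⟨fun n => ⌊(t : ℝ) * ((n : ℝ) + 1)⌋₊, fun n => ?_, ?_⟩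
  · refine Nat.floor_le_of_le ?_
    push_cast
    have := t.2.2
    have : (0 : ℝ) ≤ (n : ℝ) + 1 := by positivity
    nlinarith
  · have h1 : Tendsto (fun n : ℕ => (n : ℝ) + 1) atTop atTop :=
      tendsto_atTop_add_const_right _ _ tendsto_natCast_atTop_atTop
    have h2 := (tendsto_nat_floor_mul_div_atTop (R := ℝ) t.2.1).comp h1
    have h3 := (continuous_projIcc (h := zero_le_one (α := ℝ))).tendsto (t : ℝ) |>.comp h2
    rw [projIcc_val] at h3
    exact h3

/-- **Doob's inequality** in `L²` for processes with continuous paths. -/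
theorem IsL2Martingale.lintegral_iSup_sq_le {Ω : Type*} {m : MeasurableSpace Ω}
    {ℱ : Filtration I m} {μ : Measure Ω} {X : I → Ω → ℝ} (hX : IsL2Martingale ℱ μ X)
    (hc : ∀ᵐ ω ∂μ, Continuous fun t => X t ω) :
    ∫⁻ ω, ⨆ t, ‖X t ω‖ₑ ^ 2 ∂μ ≤ 4 * ∫⁻ ω, ‖X 1 ω‖ₑ ^ 2 ∂μ := by
  set A : ℕ → Ω → ℝ := fun n => runMax (fun i => X (gridPoint n i)) (n + 1) with hA
  have hM := fun n => hX.comp_mono (gridPoint_mono n)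
  -- Each `X t ω` is a limit of values at grid points, so the supremum lies below the liminf of the
  -- grid maxima. The grids are not nested, which is why Fatou replaces monotone convergence.
  have h1 : ∫⁻ ω, ⨆ t, ‖X t ω‖ₑ ^ 2 ∂μ ≤ ∫⁻ ω, liminf (fun n => ‖A n ω‖ₑ ^ 2) atTop ∂μ := by
    refine lintegral_mono_ae ?_
    filter_upwards [hc] with ω hω
    refine iSup_le fun t => ?_
    obtain ⟨i, hi, ht⟩ := exists_gridPoint_tendsto t
    have h2 : Tendsto (fun n => ‖X (gridPoint n (i n)) ω‖ₑ ^ 2) atTop (𝓝 (‖X t ω‖ₑ ^ 2)) :=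
      ((ENNReal.continuous_pow 2).comp (continuous_enorm.comp hω)).continuousAt.tendsto.comp ht
    rw [← h2.liminf_eq]
    refine liminf_le_liminf (Eventually.of_forall fun n => ?_)
    have h3 := abs_le_runMax (fun i => X (gridPoint n i)) (hi n) ω
    simp only [hA]
    gcongr
    rw [Real.enorm_eq_ofReal_abs, Real.enorm_eq_ofReal_abs]
    exact ENNReal.ofReal_le_ofReal (h3.trans (le_abs_self _))
  refine h1.trans ((lintegral_liminf_le' fun n => ?_).trans ?_)
  · exact (((hM n).runMax_memLp (n + 1)).1.enorm.pow_const 2)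
  · refine liminf_le_of_frequently_le' (Frequently.of_forall fun n => ?_)
    refine ((hM n).lintegral_runMax_sq_le (n + 1)).trans ?_
    simp only [gridPoint_last, le_refl]

/-! ### Moments of the canonical process under one measure -/

section Canonical

variable {d : ℕ} {P : Measure (PathSpace d)} {q : I → PathSpace d → Matrix (Fin d) (Fin d) ℝ}

theorem stronglyMeasurable_B (t : I) : StronglyMeasurable[canonFiltration d t] (B (d := d) t) :=
  Filtration.stronglyAdapted_natural (fun t => (measurable_B t).stronglyMeasurable) t

theorem continuous_B (ω : PathSpace d) : Continuous fun t => B t ω := ω.1.continuous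

theorem stronglyMeasurable_B_apply {s t : I} (h : s ≤ t) (i : Fin d) :
    StronglyMeasurable[canonFiltration d t] (fun ω => B s ω i) :=
  ((EuclideanSpace.proj (𝕜 := ℝ) i).continuous.comp_stronglyMeasurable
    (stronglyMeasurable_B s)).mono ((canonFiltration d).mono h)

theorem martingale_B_apply [IsFiniteMeasure P]
    (hB : Martingale (fun t => B (d := d) t) (canonFiltration d) P) (i : Fin d) :
    Martingale (fun t ω => B t ω i) (canonFiltration d) P := by
  refine ⟨fun t => stronglyMeasurable_B_apply le_rfl i, fun s t hst => ?_⟩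
  have h1 := (EuclideanSpace.proj (𝕜 := ℝ) i).comp_condExp_comm (m := canonFiltration d s)
    (hB.integrable t)
  filter_upwards [h1, hB.condExp_ae_eq hst] with ω e1 e2
  have e3 := e1.symm
  simp only [Function.comp_apply, e2] at e3
  exact e3

theorem IsQVDensity.symm (hq : IsQVDensity P q) (t : I) (ω : PathSpace d) (i j : Fin d) :
    q t ω i j = q t ω j i := by
  have := (hq.posSemidef t ω).isHermitian.apply j i
  simpa using this

/-- The quadratic covariation, weighted by a random variable and integrated. -/
def weightedCov (P : Measure (PathSpace d)) (q : I → PathSpace d → Matrix (Fin d) (Fin d) ℝ)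
    (Z : PathSpace d → ℝ) (i j : Fin d) (x : I) : ℝ :=
  ∫ p : I × PathSpace d, (Iic x).indicator 1 p.1 * (Z p.2 * q p.1 p.2 i j) ∂(volume.prod P)

theorem IsQVDensity.integrable_mul [SFinite P] (hq : IsQVDensity P q) {Z : PathSpace d → ℝ}
    (hZ : Measurable Z) {C : ℝ} (hC : ∀ ω, |Z ω| ≤ C) (i j : Fin d) :
    Integrable (fun p : I × PathSpace d => Z p.2 * q p.1 p.2 i j) (volume.prod P) :=
  (hq.integrable i j).bdd_mul (hZ.comp measurable_snd).aestronglyMeasurable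
    (Eventually.of_forall fun p => hC p.2)

theorem integrable_indicator_mul {α : Type*} [MeasurableSpace α] {μ : Measure (I × α)}
    {f : I × α → ℝ} (hf : Integrable f μ) {S : Set I} (hS : MeasurableSet S) :
    Integrable (fun p : I × α => S.indicator 1 p.1 * f p) μ := by
  refine hf.bdd_mul (c := 1) ?_ (Eventually.of_forall fun p => ?_)
  · exact ((measurable_one.indicator hS).comp measurable_fst).aestronglyMeasurable
  · by_cases h : p.1 ∈ S <;> simp [h]

theorem IsQVDensity.integrable_cumulative [SFinite P] (hq : IsQVDensity P q) (i j : Fin d)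
    (x : I) : Integrable (fun ω => ∫ s in Iic x, q s ω i j) P := by
  have h := (integrable_indicator_mul (hq.integrable i j)
    (measurableSet_Iic (a := x))).integral_prod_right
  refine h.congr (Eventually.of_forall fun ω => ?_)
  simp only
  rw [← integral_indicator measurableSet_Iic]
  congr 1; ext s
  by_cases hs : s ∈ Iic x <;> simp [hs]

theorem IsQVDensity.weightedCov_eq [SFinite P] (hq : IsQVDensity P q) {Z : PathSpace d → ℝ}
    (hZ : Measurable Z) {C : ℝ} (hC : ∀ ω, |Z ω| ≤ C) (i j : Fin d) (x : I) :
    weightedCov P q Z i j x = ∫ ω, (Z ω * ∫ s in Iic x, q s ω i j) ∂P := by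
  rw [weightedCov, integral_prod_symm _ (integrable_indicator_mul (hq.integrable_mul hZ hC i j)
    measurableSet_Iic)]
  refine integral_congr_ae (Eventually.of_forall fun ω => ?_)
  simp only
  rw [← integral_const_mul, ← integral_indicator measurableSet_Iic]
  congr 1; ext s
  by_cases hs : s ∈ Iic x <;> simp [hs]

/-- Square integrability comes from the density: `(B^i)²` is the sum of the integrable martingale
`(B^i)² - ∫ q^{ii}` and the integrable process `∫ q^{ii}`. -/
theorem IsQVDensity.memLp_B_apply [IsFiniteMeasure P] (hq : IsQVDensity P q) (t : I)
    (i : Fin d) : MemLp (fun ω => B t ω i) 2 P := by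
  have hm : StronglyMeasurable (fun ω => B (d := d) t ω i) :=
    (stronglyMeasurable_B_apply le_rfl i).mono ((canonFiltration d).le t)
  rw [memLp_two_iff_integrable_sq hm.aestronglyMeasurable]
  refine (((hq.martingale i i).integrable t).add (hq.integrable_cumulative i i t)).congr
    (Eventually.of_forall fun ω => ?_)
  simp only [Pi.add_apply]
  ring

theorem isL2Martingale_B_apply [IsFiniteMeasure P]
    (hB : Martingale (fun t => B (d := d) t) (canonFiltration d) P) (hq : IsQVDensity P q)
    (i : Fin d) : IsL2Martingale (canonFiltration d) P (fun t ω => B t ω i) :=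
  (martingale_B_apply hB i).isL2Martingale fun t => hq.memLp_B_apply t i

theorem memLp_two_bdd_mul {Ω : Type*} {m : MeasurableSpace Ω} {μ : Measure Ω} {Z f : Ω → ℝ}
    (hf : MemLp f 2 μ) (hZ : Measurable Z) {C : ℝ} (hC : ∀ ω, |Z ω| ≤ C) :
    MemLp (fun ω => Z ω * f ω) 2 μ := by
  refine (hf.const_mul C).of_le (hZ.aestronglyMeasurable.mul hf.1)
    (Eventually.of_forall fun ω => ?_)
  rw [norm_mul, norm_mul]
  exact mul_le_mul_of_nonneg_right ((hC ω).trans (le_abs_self C)) (norm_nonneg _)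

theorem integral_sub_sub_sub {Ω : Type*} {m : MeasurableSpace Ω} {μ : Measure Ω}
    {f₁ f₂ f₃ f₄ : Ω → ℝ} (h₁ : Integrable f₁ μ) (h₂ : Integrable f₂ μ) (h₃ : Integrable f₃ μ)
    (h₄ : Integrable f₄ μ) :
    ∫ ω, (f₁ ω - f₂ ω - (f₃ ω - f₄ ω)) ∂μ
      = ∫ ω, f₁ ω ∂μ - ∫ ω, f₂ ω ∂μ - (∫ ω, f₃ ω ∂μ - ∫ ω, f₄ ω ∂μ) := by
  rw [← integral_sub h₁ h₂, ← integral_sub h₃ h₄]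
  exact integral_sub (h₁.sub h₂) (h₃.sub h₄)

/-- The covariance of the canonical process at two times, conditionally on an earlier time. -/
theorem exists_integral_mul_B_mul_B [IsFiniteMeasure P]
    (hB : Martingale (fun t => B (d := d) t) (canonFiltration d) P) (hq : IsQVDensity P q)
    {r : I} {Z : PathSpace d → ℝ} (hZ : StronglyMeasurable[canonFiltration d r] Z) {C : ℝ}
    (hC : ∀ ω, |Z ω| ≤ C) (i j : Fin d) :
    ∃ c : ℝ, ∀ a b, r ≤ a → r ≤ b →
      ∫ ω, Z ω * (B a ω i * B b ω j) ∂P = c + weightedCov P q Z i j (min a b) := by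
  have hZm : Measurable Z := (hZ.mono ((canonFiltration d).le r)).measurable
  have hBB : ∀ a b (i j : Fin d), Integrable (fun ω => Z ω * (B a ω i * B b ω j)) P :=
    fun a b i j => (memLp_two_mul_integrable (hq.memLp_B_apply a i) (hq.memLp_B_apply b j)).bdd_mul
      hZm.aestronglyMeasurable (Eventually.of_forall hC)
  have hQ : ∀ x, Integrable (fun ω => Z ω * ∫ s in Iic x, q s ω i j) P := fun x =>
    (hq.integrable_cumulative i j x).bdd_mul hZm.aestronglyMeasurable (Eventually.of_forall hC)
  have hN : ∀ x, Integrable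
      (fun ω => Z ω * (B x ω i * B x ω j - ∫ s in Iic x, q s ω i j)) P := fun x =>
    ((hBB x x i j).sub (hQ x)).congr (Eventually.of_forall fun ω => by
      simp only [Pi.sub_apply]; ring)
  have diag : ∀ a, r ≤ a → ∫ ω, Z ω * (B a ω i * B a ω j) ∂P
      = ∫ ω, Z ω * (B r ω i * B r ω j - ∫ s in Iic r, q s ω i j) ∂P
        + weightedCov P q Z i j a := by
    intro a ha
    have h := integral_mul_martingale_sub (hq.martingale i j) ha hZ (hN r) (hN a)
    simp_rw [mul_sub (Z _) (B a _ i * B a _ j - _)] at h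
    rw [integral_sub (hN a) (hN r), sub_eq_zero] at h
    rw [← h, hq.weightedCov_eq hZm hC, ← integral_add (hN a) (hQ a)]
    congr 1; ext ω; ring
  -- The increment of `B^j` from `a` to `b` is orthogonal to `Z * B a i`, so the later time may be
  -- moved down to the earlier one.
  have off : ∀ a b, r ≤ a → a ≤ b → ∀ i j : Fin d,
      ∫ ω, Z ω * (B a ω i * B b ω j) ∂P = ∫ ω, Z ω * (B a ω i * B a ω j) ∂P := by
    intro a b ha hab i j
    have h := (isL2Martingale_B_apply hB hq j).orthogonal a b hab (fun ω => Z ω * B a ω i)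
      ((hZ.mono ((canonFiltration d).mono ha)).mul (stronglyMeasurable_B_apply le_rfl i))
      (memLp_two_bdd_mul (hq.memLp_B_apply a i) hZm hC)
    rw [← sub_eq_zero, ← integral_sub (hBB _ _ _ _) (hBB _ _ _ _), ← h]
    congr 1; ext ω; ring
  -- This constant depends on `r` but not on `a`, `b`, so it cancels in the second differences that
  -- increments produce.
  refine ⟨∫ ω, Z ω * (B r ω i * B r ω j - ∫ s in Iic r, q s ω i j) ∂P, fun a b ha hb => ?_⟩
  rcases le_total a b with hab | hab
  · rw [min_eq_left hab, off a b ha hab, diag a ha]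
  · rw [min_eq_right hab, ← diag b hb, show (fun ω => Z ω * (B b ω i * B b ω j)) =
      fun ω => Z ω * (B b ω j * B b ω i) by ext ω; ring, ← off b a hb hab j i]
    congr 1; ext ω; ring

theorem indicator_Iic_sub {u v s : I} (h : u ≤ v) :
    (Iic v).indicator (1 : I → ℝ) s - (Iic u).indicator 1 s = (Ioc u v).indicator 1 s := by
  by_cases h1 : s ≤ u
  · have h2 : s ≤ v := h1.trans h
    simp [indicator, h1, h2, not_lt.mpr h1]
  · by_cases h2 : s ≤ v <;> simp [indicator, h1, h2, not_le.mp h1]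

theorem indicator_Iic_min (u v s : I) :
    (Iic (min u v)).indicator (1 : I → ℝ) s = (Iic u).indicator 1 s * (Iic v).indicator 1 s := by
  by_cases h1 : s ≤ u <;> by_cases h2 : s ≤ v <;> simp [indicator, h1, h2]

/-- Inclusion–exclusion: an interval indicator is a difference of indicators of `Iic`, and products
of those are indicators of `Iic` at the minimum. `Ico` may be traded for `Ioc` because Lebesgue
measure has no atoms. -/
theorem integral_indicator_Ico_mul [SFinite P] (hq : IsQVDensity P q) {Z : PathSpace d → ℝ}
    (hZ : Measurable Z) {C : ℝ} (hC : ∀ ω, |Z ω| ≤ C) (i j : Fin d) {u v u' v' : I}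
    (h : u ≤ v) (h' : u' ≤ v') :
    ∫ p : I × PathSpace d, (Ico u v).indicator 1 p.1 * ((Ico u' v').indicator 1 p.1 *
      (Z p.2 * q p.1 p.2 i j)) ∂(volume.prod P)
      = weightedCov P q Z i j (min v v') - weightedCov P q Z i j (min v u')
        - (weightedCov P q Z i j (min u v') - weightedCov P q Z i j (min u u')) := by
  have hi := fun x : I => integrable_indicator_mul (hq.integrable_mul hZ hC i j)
    (measurableSet_Iic (a := x))
  have e : ∀ u v : I, (fun p : I × PathSpace d => (Ico u v).indicator (1 : I → ℝ) p.1)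
      =ᵐ[volume.prod P] fun p => (Ioc u v).indicator 1 p.1 := by
    intro u v
    have h1 : (Ico u v).indicator (1 : I → ℝ) =ᵐ[volume] (Ioc u v).indicator 1 :=
      indicator_ae_eq_of_ae_eq_set Ico_ae_eq_Ioc
    exact Measure.quasiMeasurePreserving_fst.ae_eq_comp h1
  simp only [weightedCov]
  rw [← integral_sub_sub_sub (hi _) (hi _) (hi _) (hi _)]
  refine integral_congr_ae ?_
  filter_upwards [e u v, e u' v'] with p e1 e2
  rw [e1, e2, ← indicator_Iic_sub h, ← indicator_Iic_sub h']
  simp only [indicator_Iic_min]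
  ring

/-- The first increment is cut at `u'`. Its part before `u'` is known at `u'`, hence orthogonal to
the second increment. The part after `u'` expands into four covariances, to which
`exists_integral_mul_B_mul_B` applies from time `u'`. -/
theorem integral_increment_mul_increment_of_le [IsFiniteMeasure P]
    (hB : Martingale (fun t => B (d := d) t) (canonFiltration d) P) (hq : IsQVDensity P q)
    {u v u' v' : I} (huv : u ≤ v) (huv' : u' ≤ v') (huu' : u ≤ u')
    {Z : PathSpace d → ℝ} (hZ : StronglyMeasurable[canonFiltration d u'] Z) {C : ℝ}
    (hC : ∀ ω, |Z ω| ≤ C) (i j : Fin d) :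
    ∫ ω, Z ω * ((B v ω i - B u ω i) * (B v' ω j - B u' ω j)) ∂P
      = ∫ p : I × PathSpace d, (Ico u v).indicator 1 p.1 * ((Ico u' v').indicator 1 p.1 *
        (Z p.2 * q p.1 p.2 i j)) ∂(volume.prod P) := by
  have hZm : Measurable Z := (hZ.mono ((canonFiltration d).le u')).measurable
  rw [integral_indicator_Ico_mul hq hZm hC i j huv huv']
  have hBB : ∀ a b, Integrable (fun ω => Z ω * (B a ω i * B b ω j)) P :=
    fun a b => (memLp_two_mul_integrable (hq.memLp_B_apply a i) (hq.memLp_B_apply b j)).bdd_mul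
      hZm.aestronglyMeasurable (Eventually.of_forall hC)
  have orth : ∀ w ≤ u', ∫ ω, Z ω * ((B w ω i - B u ω i) * (B v' ω j - B u' ω j)) ∂P = 0 := by
    intro w hw
    rw [← (isL2Martingale_B_apply hB hq j).orthogonal u' v' huv'
      (fun ω => Z ω * (B w ω i - B u ω i))
      (hZ.mul ((stronglyMeasurable_B_apply hw i).sub (stronglyMeasurable_B_apply huu' i)))
      (memLp_two_bdd_mul ((hq.memLp_B_apply w i).sub (hq.memLp_B_apply u i)) hZm hC)]
    congr 1; ext ω; ring
  rcases le_total v u' with hvu | hvu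
  · rw [orth v hvu, min_eq_left (hvu.trans huv'), min_eq_left hvu,
      min_eq_left (huu'.trans huv'), min_eq_left huu']
    ring
  · obtain ⟨c, hc⟩ := exists_integral_mul_B_mul_B hB hq hZ hC i j
    have h1 : ∫ ω, Z ω * ((B v ω i - B u ω i) * (B v' ω j - B u' ω j)) ∂P
        = ∫ ω, Z ω * ((B v ω i - B u' ω i) * (B v' ω j - B u' ω j)) ∂P
          + ∫ ω, Z ω * ((B u' ω i - B u ω i) * (B v' ω j - B u' ω j)) ∂P := by
      have hi : ∀ a b, Integrable
          (fun ω => Z ω * ((B a ω i - B b ω i) * (B v' ω j - B u' ω j))) P := fun a b =>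
        (((hBB a v').sub (hBB a u')).sub ((hBB b v').sub (hBB b u'))).congr
          (Eventually.of_forall fun ω => by simp only [Pi.sub_apply]; ring)
      rw [← integral_add (hi _ _) (hi _ _)]
      congr 1; ext ω; ring
    have h2 : ∫ ω, Z ω * ((B v ω i - B u' ω i) * (B v' ω j - B u' ω j)) ∂P
        = ∫ ω, Z ω * (B v ω i * B v' ω j) ∂P - ∫ ω, Z ω * (B v ω i * B u' ω j) ∂P
          - (∫ ω, Z ω * (B u' ω i * B v' ω j) ∂P - ∫ ω, Z ω * (B u' ω i * B u' ω j) ∂P) := by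
      rw [← integral_sub_sub_sub (hBB _ _) (hBB _ _) (hBB _ _) (hBB _ _)]
      congr 1; ext ω; ring
    rw [h1, orth u' le_rfl, h2, hc _ _ hvu huv', hc _ _ hvu le_rfl, hc _ _ le_rfl huv',
      hc _ _ le_rfl le_rfl, min_eq_right hvu, min_eq_left huv', min_self,
      min_eq_left (huu'.trans huv'), min_eq_left huu']
    ring

/-- The product `h * h'` is known at the later of the two left endpoints, so it can serve as the
weight `Z`. The other order of endpoints uses the symmetry of `q`. -/
theorem integral_increment_mul_increment [IsFiniteMeasure P]
    (hB : Martingale (fun t => B (d := d) t) (canonFiltration d) P) (hq : IsQVDensity P q)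
    {u v u' v' : I} (huv : u ≤ v) (huv' : u' ≤ v') {h h' : PathSpace d → ℝ}
    (hh : StronglyMeasurable[canonFiltration d u] h)
    (hh' : StronglyMeasurable[canonFiltration d u'] h') {C C' : ℝ}
    (hC : ∀ ω, |h ω| ≤ C) (hC' : ∀ ω, |h' ω| ≤ C') (i j : Fin d) :
    ∫ ω, h ω * (B v ω i - B u ω i) * (h' ω * (B v' ω j - B u' ω j)) ∂P
      = ∫ p : I × PathSpace d, (Ico u v).indicator 1 p.1 * ((Ico u' v').indicator 1 p.1 *
        (h p.2 * h' p.2 * q p.1 p.2 i j)) ∂(volume.prod P) := by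
  have hCC : ∀ ω, |h ω * h' ω| ≤ C * C' := fun ω => by
    rw [abs_mul]
    exact mul_le_mul (hC ω) (hC' ω) (abs_nonneg _) ((abs_nonneg _).trans (hC ω))
  rcases le_total u u' with hu | hu
  · refine Eq.trans ?_ (integral_increment_mul_increment_of_le hB hq huv huv' hu
      ((hh.mono ((canonFiltration d).mono hu)).mul hh') hCC i j)
    congr 1; ext ω; simp only [Pi.mul_apply]; ring
  · have := integral_increment_mul_increment_of_le hB hq huv' huv hu
      (hh.mul (hh'.mono ((canonFiltration d).mono hu))) hCC j i
    refine Eq.trans ?_ (this.trans ?_)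
    · congr 1; ext ω; simp only [Pi.mul_apply]; ring
    · congr 1; ext p
      rw [hq.symm p.1 p.2 j i]; simp only [Pi.mul_apply]; ring

end Canonical

/-! ### Simple integrands -/

section Simple

variable {d : ℕ} {P : Measure (PathSpace d)} {q : I → PathSpace d → Matrix (Fin d) (Fin d) ℝ}

/-- The density `q X · Y` of the covariation of the integrals of `X` and `Y`. -/
def covDensity (q : I → PathSpace d → Matrix (Fin d) (Fin d) ℝ) (X Y : I → PathSpace d → Vec d)
    (p : I × PathSpace d) : ℝ :=
  X p.1 p.2 ⬝ᵥ (q p.1 p.2).mulVec (Y p.1 p.2)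

namespace SimpleIntegrand

variable (K L : SimpleIntegrand d)

/-- The values of a simple integrand are uniformly bounded. -/
def IsBounded : Prop := ∃ C : ℝ, ∀ i ω, ‖K.val i ω‖ ≤ C

variable {K L}

theorem stronglyMeasurable_val_apply (i : Fin K.n) (a : Fin d) :
    StronglyMeasurable[canonFiltration d (K.time i.castSucc)] (fun ω => K.val i ω a) :=
  ((EuclideanSpace.proj (𝕜 := ℝ) a).continuous.measurable.comp
    (K.val_measurable i)).stronglyMeasurable

theorem time_le (i : Fin K.n) : K.time i.castSucc ≤ K.time i.succ :=
  K.time_mono Fin.castSucc_lt_succ.le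

theorem IsBounded.abs_apply_le (hK : K.IsBounded) : ∃ C : ℝ, ∀ i ω a, |K.val i ω a| ≤ C := by
  obtain ⟨C, hC⟩ := hK
  exact ⟨C, fun i ω a => (PiLp.norm_apply_le (K.val i ω) a).trans (hC i ω)⟩

theorem process_apply (s : I) (ω : PathSpace d) (a : Fin d) :
    K.process s ω a = ∑ i : Fin K.n,
      (Ico (K.time i.castSucc) (K.time i.succ)).indicator 1 s * K.val i ω a := by
  simp only [process, WithLp.ofLp_sum, Finset.sum_apply]
  refine Finset.sum_congr rfl fun i _ => ?_
  by_cases h : s ∈ Ico (K.time i.castSucc) (K.time i.succ) <;> simp [h]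

theorem integral_eq_sum (s : I) (ω : PathSpace d) :
    K.integral s ω = ∑ a : Fin d, ∑ i : Fin K.n, K.val i ω a *
      (B (min s (K.time i.succ)) ω a - B (min s (K.time i.castSucc)) ω a) := by
  rw [integral, Finset.sum_comm]
  refine Finset.sum_congr rfl fun i _ => ?_
  rw [PiLp.inner_apply]
  refine Finset.sum_congr rfl fun a _ => ?_
  simp [mul_comm]

theorem integral_one_eq_sum (ω : PathSpace d) :
    K.integral 1 ω = ∑ a : Fin d, ∑ i : Fin K.n, K.val i ω a *
      (B (K.time i.succ) ω a - B (K.time i.castSucc) ω a) := by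
  rw [integral_eq_sum]
  simp only [min_eq_right (unitInterval.le_one' (t := _))]

theorem covDensity_process (p : I × PathSpace d) :
    covDensity q K.process L.process p = ∑ a, ∑ b, ∑ i, ∑ j,
      (Ico (K.time i.castSucc) (K.time i.succ)).indicator 1 p.1 *
        ((Ico (L.time j.castSucc) (L.time j.succ)).indicator 1 p.1 *
          (K.val i p.2 a * L.val j p.2 b * q p.1 p.2 a b)) := by
  simp only [covDensity, dotProduct, Matrix.mulVec, process_apply]
  refine Finset.sum_congr rfl fun a _ => ?_
  rw [Finset.mul_sum]
  refine Finset.sum_congr rfl fun b _ => ?_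
  rw [mul_left_comm, Finset.sum_mul_sum, Finset.mul_sum]
  refine Finset.sum_congr rfl fun i _ => ?_
  rw [Finset.mul_sum]
  refine Finset.sum_congr rfl fun j _ => ?_
  ring

theorem continuous_integral (ω : PathSpace d) : Continuous fun s => K.integral s ω := by
  unfold integral
  refine continuous_finsetSum _ fun i _ => Continuous.inner continuous_const ?_
  exact ((continuous_B ω).comp (continuous_id.min continuous_const)).sub
    ((continuous_B ω).comp (continuous_id.min continuous_const))

/-- One term of the integral of a simple integrand is adapted. -/
theorem stronglyMeasurable_mul_increment {u v : I} (huv : u ≤ v) {h : PathSpace d → ℝ}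
    (hh : StronglyMeasurable[canonFiltration d u] h) (a : Fin d) (t : I) :
    StronglyMeasurable[canonFiltration d t]
      (fun ω => h ω * (B (min t v) ω a - B (min t u) ω a)) := by
  rcases le_total t u with htu | htu
  · simp only [min_eq_left htu, min_eq_left (htu.trans huv), sub_self, mul_zero]
    exact stronglyMeasurable_const
  · exact (hh.mono ((canonFiltration d).mono htu)).mul
      ((stronglyMeasurable_B_apply (min_le_left _ _) a).sub
        (stronglyMeasurable_B_apply (min_le_left _ _) a))

/-- Adaptedness and continuity of every path suffice, so the raw filtration needs no completion. -/
theorem isStronglyProgressive_integral :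
    IsStronglyProgressive (canonFiltration d) K.integral := by
  refine StronglyAdapted.isStronglyProgressive_of_continuous (fun t => ?_) continuous_integral
  have : K.integral t = fun ω => ∑ a : Fin d, ∑ i : Fin K.n, K.val i ω a *
      (B (min t (K.time i.succ)) ω a - B (min t (K.time i.castSucc)) ω a) :=
    funext fun ω => integral_eq_sum t ω
  rw [this]
  exact Finset.stronglyMeasurable_fun_sum _ fun a _ => Finset.stronglyMeasurable_fun_sum _ fun i _ =>
    stronglyMeasurable_mul_increment (time_le i) (stronglyMeasurable_val_apply i a) a t

theorem measurable_integral (t : I) : Measurable (K.integral t) :=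
  ((isStronglyProgressive_integral.stronglyAdapted t).mono ((canonFiltration d).le t)).measurable

theorem isL2Martingale_mul_increment [IsFiniteMeasure P]
    (hB : Martingale (fun t => B (d := d) t) (canonFiltration d) P) (hq : IsQVDensity P q)
    {u v : I} (huv : u ≤ v) {h : PathSpace d → ℝ}
    (hh : StronglyMeasurable[canonFiltration d u] h) {C : ℝ} (hC : ∀ ω, |h ω| ≤ C) (a : Fin d) :
    IsL2Martingale (canonFiltration d) P
      (fun t ω => h ω * (B (min t v) ω a - B (min t u) ω a)) where
  adapted := stronglyMeasurable_mul_increment huv hh a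
  memLp t := memLp_two_bdd_mul ((hq.memLp_B_apply _ a).sub (hq.memLp_B_apply _ a))
    (hh.mono ((canonFiltration d).le u)).measurable hC
  orthogonal s t hst Z hZ hZ2 := by
    have hM := isL2Martingale_B_apply hB hq a
    have hm : Measurable h := (hh.mono ((canonFiltration d).le u)).measurable
    have hZh : MemLp (fun ω => Z ω * h ω) 2 P := by
      simp_rw [mul_comm (Z _)]
      exact memLp_two_bdd_mul hZ2 hm hC
    rcases le_total s u with hsu | hsu
    · have h1 : ∀ w, u ≤ w → ∫ ω, Z ω * h ω * (B w ω a - B u ω a) ∂P = 0 := fun w hw =>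
        hM.orthogonal u w hw _ ((hZ.mono ((canonFiltration d).mono hsu)).mul hh) hZh
      simp only [min_eq_left hsu, min_eq_left (hsu.trans huv), sub_self, mul_zero, sub_zero]
      rcases le_total t u with htu | htu
      · simp only [min_eq_left htu, min_eq_left (htu.trans huv), sub_self, mul_zero,
          integral_zero]
      · rw [min_eq_right htu, ← h1 (min t v) (le_min htu huv)]
        congr 1; ext ω; ring
    · rw [min_eq_right hsu, min_eq_right (hsu.trans hst)]
      -- The weight must be known at `min s v`, and `Z * h` is known only at `s`. It is therefore
      -- set to zero when `v < s`, where the stopped increment vanishes anyway.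
      rw [← hM.orthogonal (min s v) (min t v) (min_le_min_right v hst) (fun ω =>
        if s ≤ v then Z ω * h ω else 0) ?_ ?_]
      · refine integral_congr_ae (Eventually.of_forall fun ω => ?_)
        simp only
        split_ifs with hsv
        · ring
        · rw [min_eq_right (not_le.mp hsv).le, min_eq_right ((not_le.mp hsv).le.trans hst)]
          ring
      · by_cases hsv : s ≤ v
        · simp only [hsv, if_true]
          rw [min_eq_left hsv]
          exact hZ.mul (hh.mono ((canonFiltration d).mono hsu))
        · simp only [hsv, if_false]
          exact stronglyMeasurable_const
      · by_cases hsv : s ≤ v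
        · simp only [hsv, if_true]
          exact hZh
        · simp only [hsv, if_false]
          exact MemLp.zero

theorem IsBounded.isL2Martingale_integral [IsFiniteMeasure P]
    (hB : Martingale (fun t => B (d := d) t) (canonFiltration d) P) (hq : IsQVDensity P q)
    (hK : K.IsBounded) : IsL2Martingale (canonFiltration d) P K.integral := by
  obtain ⟨C, hC⟩ := hK.abs_apply_le
  have : K.integral = fun t ω => ∑ a : Fin d, ∑ i : Fin K.n, K.val i ω a *
      (B (min t (K.time i.succ)) ω a - B (min t (K.time i.castSucc)) ω a) :=
    funext fun t => funext fun ω => integral_eq_sum t ω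
  rw [this]
  exact IsL2Martingale.sum _ fun a _ => IsL2Martingale.sum _ fun i _ =>
    isL2Martingale_mul_increment hB hq (time_le i) (stronglyMeasurable_val_apply i a)
      (fun ω => hC i ω a) a

theorem IsBounded.integrable_covDensity_term [IsFiniteMeasure P] (hq : IsQVDensity P q)
    (hK : K.IsBounded) (hL : L.IsBounded) (a b : Fin d) (i : Fin K.n) (j : Fin L.n) :
    Integrable (fun p : I × PathSpace d =>
      (Ico (K.time i.castSucc) (K.time i.succ)).indicator 1 p.1 *
        ((Ico (L.time j.castSucc) (L.time j.succ)).indicator 1 p.1 *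
          (K.val i p.2 a * L.val j p.2 b * q p.1 p.2 a b))) (volume.prod P) := by
  obtain ⟨C, hC⟩ := hK.abs_apply_le
  obtain ⟨C', hC'⟩ := hL.abs_apply_le
  refine integrable_indicator_mul (integrable_indicator_mul (hq.integrable_mul
    (Z := fun ω => K.val i ω a * L.val j ω b) (C := C * C') ?_ ?_ a b) measurableSet_Ico)
    measurableSet_Ico
  · exact (((stronglyMeasurable_val_apply i a).mono ((canonFiltration d).le _)).mul
      ((stronglyMeasurable_val_apply j b).mono ((canonFiltration d).le _))).measurable
  · intro ω
    rw [abs_mul]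
    exact mul_le_mul (hC i ω a) (hC' j ω b) (abs_nonneg _) ((abs_nonneg _).trans (hC i ω a))

theorem IsBounded.integrable_covDensity [IsFiniteMeasure P] (hq : IsQVDensity P q)
    (hK : K.IsBounded) (hL : L.IsBounded) :
    Integrable (covDensity q K.process L.process) (volume.prod P) := by
  rw [funext (covDensity_process (q := q) (K := K) (L := L))]
  exact integrable_finsetSum _ fun a _ => integrable_finsetSum _ fun b _ =>
    integrable_finsetSum _ fun i _ => integrable_finsetSum _ fun j _ =>
      integrable_covDensity_term hq hK hL a b i j

/-- The **Itô isometry** for bounded simple integrands, in polarized form. -/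
theorem IsBounded.integral_mul_integral [IsFiniteMeasure P]
    (hB : Martingale (fun t => B (d := d) t) (canonFiltration d) P) (hq : IsQVDensity P q)
    (hK : K.IsBounded) (hL : L.IsBounded) :
    ∫ ω, K.integral 1 ω * L.integral 1 ω ∂P
      = ∫ p, covDensity q K.process L.process p ∂(volume.prod P) := by
  obtain ⟨C, hC⟩ := hK.abs_apply_le
  obtain ⟨C', hC'⟩ := hL.abs_apply_le
  have hI := fun a b i j => integrable_covDensity_term (q := q) hq hK hL a b i j
  have hm : ∀ (K : SimpleIntegrand d), K.IsBounded → ∀ i a,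
      MemLp (fun ω => K.val i ω a * (B (K.time i.succ) ω a - B (K.time i.castSucc) ω a)) 2 P := by
    intro K hK i a
    obtain ⟨C, hC⟩ := hK.abs_apply_le
    exact memLp_two_bdd_mul ((hq.memLp_B_apply _ a).sub (hq.memLp_B_apply _ a))
      ((stronglyMeasurable_val_apply i a).mono ((canonFiltration d).le _)).measurable
      (fun ω => hC i ω a)
  have hJ := fun i j a b => memLp_two_mul_integrable (hm K hK i a) (hm L hL j b)
  simp_rw [covDensity_process, integral_one_eq_sum, Finset.sum_mul_sum]
  rw [integral_finsetSum _ fun a _ => integrable_finsetSum _ fun b _ =>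
      integrable_finsetSum _ fun i _ => integrable_finsetSum _ fun j _ => hJ i j a b,
    integral_finsetSum _ fun a _ => integrable_finsetSum _ fun b _ =>
      integrable_finsetSum _ fun i _ => integrable_finsetSum _ fun j _ => hI a b i j]
  refine Finset.sum_congr rfl fun a _ => ?_
  rw [integral_finsetSum _ fun b _ =>
      integrable_finsetSum _ fun i _ => integrable_finsetSum _ fun j _ => hJ i j a b,
    integral_finsetSum _ fun b _ =>
      integrable_finsetSum _ fun i _ => integrable_finsetSum _ fun j _ => hI a b i j]
  refine Finset.sum_congr rfl fun b _ => ?_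
  rw [integral_finsetSum _ fun i _ => integrable_finsetSum _ fun j _ => hJ i j a b,
    integral_finsetSum _ fun i _ => integrable_finsetSum _ fun j _ => hI a b i j]
  refine Finset.sum_congr rfl fun i _ => ?_
  rw [integral_finsetSum _ fun j _ => hJ i j a b, integral_finsetSum _ fun j _ => hI a b i j]
  refine Finset.sum_congr rfl fun j _ => ?_
  exact integral_increment_mul_increment hB hq (time_le i) (time_le j)
    (stronglyMeasurable_val_apply i a) (stronglyMeasurable_val_apply j b)
    (fun ω => hC i ω a) (fun ω => hC' j ω b) a b

end SimpleIntegrand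

end Simple

/-! ### The energy seminorm of integrands -/

section Energy

variable {d : ℕ} {P : Measure (PathSpace d)} {q : I → PathSpace d → Matrix (Fin d) (Fin d) ℝ}
  {X Y Z : I → PathSpace d → Vec d}

theorem eLpNorm_two_sq {Ω E : Type*} [ENorm E] {m : MeasurableSpace Ω}
    {μ : Measure Ω} (f : Ω → E) : eLpNorm f 2 μ ^ 2 = ∫⁻ ω, ‖f ω‖ₑ ^ 2 ∂μ := by
  rw [eLpNorm_eq_lintegral_rpow_enorm_toReal two_ne_zero ENNReal.ofNat_ne_top,
    ← ENNReal.rpow_natCast, ← ENNReal.rpow_mul]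
  simp

theorem tendsto_zero_of_sq_tendsto_zero {f : ℕ → ℝ≥0∞}
    (h : Tendsto (fun n => f n ^ 2) atTop (𝓝 0)) : Tendsto f atTop (𝓝 0) := by
  have h2 := h.ennrpow_const (1 / 2)
  rw [ENNReal.zero_rpow_of_pos (by norm_num)] at h2
  refine h2.congr fun N => ?_
  rw [← ENNReal.rpow_natCast, ← ENNReal.rpow_mul]
  norm_num

open scoped MatrixOrder in
-- Factoring `A = Cᴴ C` makes the square root of the quadratic form at `z` the Euclidean norm of `C
-- z`.
theorem _root_.Matrix.PosSemidef.sqrt_add_dotProduct_le {A : Matrix (Fin d) (Fin d) ℝ}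
    (hA : A.PosSemidef) (x y : Fin d → ℝ) :
    √((x + y) ⬝ᵥ A.mulVec (x + y)) ≤ √(x ⬝ᵥ A.mulVec x) + √(y ⬝ᵥ A.mulVec y) := by
  obtain ⟨C, rfl⟩ : ∃ C : Matrix (Fin d) (Fin d) ℝ, A = C.conjTranspose * C := by
    obtain ⟨C, hC, -, rfl⟩ := CFC.exists_sqrt_of_isSelfAdjoint_of_quasispectrumRestricts
      hA.isHermitian (QuasispectrumRestricts.nnreal_of_nonneg hA.nonneg)
    exact ⟨C, by rw [← Matrix.star_eq_conjTranspose, hC.star_eq]⟩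
  have h : ∀ z : Fin d → ℝ, √(z ⬝ᵥ (C.conjTranspose * C).mulVec z)
      = ‖WithLp.toLp 2 (C.mulVec z)‖ := fun z => by
    rw [EuclideanSpace.norm_eq, ← Matrix.mulVec_mulVec, Matrix.conjTranspose_eq_transpose_of_trivial,
      Matrix.dotProduct_mulVec, Matrix.vecMul_transpose]
    simp [dotProduct, sq]
  rw [h, h, h, Matrix.mulVec_add, WithLp.toLp_add]
  exact norm_add_le _ _

/-- The seminorm `(E ∫_0^1 q_t X_t · X_t dt)^{1/2}`. -/
def energyNorm (P : Measure (PathSpace d)) (q : I → PathSpace d → Matrix (Fin d) (Fin d) ℝ)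
    (X : I → PathSpace d → Vec d) : ℝ≥0∞ :=
  eLpNorm (fun p => √(covDensity q X X p)) 2 (volume.prod P)

/-- All coordinates are jointly measurable. -/
def JointlyMeasurable (X : I → PathSpace d → Vec d) : Prop :=
  ∀ a, Measurable fun p : I × PathSpace d => X p.1 p.2 a

/-- Progressive measurability at the terminal time `1`, where `Iic 1` is the whole interval. -/
theorem _root_.MeasureTheory.IsStronglyProgressive.measurable_uncurry {E : Type*}
    [TopologicalSpace E] [TopologicalSpace.PseudoMetrizableSpace E] [MeasurableSpace E]
    [BorelSpace E] {X : I → PathSpace d → E}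
    (hX : IsStronglyProgressive (canonFiltration d) X) :
    Measurable fun p : I × PathSpace d => X p.1 p.2 := by
  have h1 := (hX 1).measurable
  have h2 : Measurable[_, MeasurableSpace.prod inferInstance (canonFiltration d 1)]
      fun p : I × PathSpace d => ((⟨p.1, p.1.2.2⟩ : Iic (1 : I)), p.2) := by
    refine Measurable.prodMk ?_ ?_
    · exact Measurable.subtype_mk measurable_fst
    · exact measurable_snd.mono le_rfl ((canonFiltration d).le 1)
  exact h1.comp h2

theorem _root_.MeasureTheory.IsStronglyProgressive.jointlyMeasurable
    (hX : IsStronglyProgressive (canonFiltration d) X) : JointlyMeasurable X := fun a =>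
  (EuclideanSpace.proj (𝕜 := ℝ) a).continuous.measurable.comp hX.measurable_uncurry

theorem JointlyMeasurable.sub (hX : JointlyMeasurable X) (hY : JointlyMeasurable Y) :
    JointlyMeasurable fun t ω => X t ω - Y t ω := fun a => (hX a).sub (hY a)

theorem SimpleIntegrand.jointlyMeasurable (K : SimpleIntegrand d) :
    JointlyMeasurable K.process := fun a => by
  simp only [SimpleIntegrand.process_apply]
  exact Finset.measurable_fun_sum _ fun i _ =>
    ((measurable_one.indicator measurableSet_Ico).comp measurable_fst).mul
      (((SimpleIntegrand.stronglyMeasurable_val_apply i a).mono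
        ((canonFiltration d).le _)).measurable.comp measurable_snd)

theorem IsQVDensity.measurable_covDensity (hq : IsQVDensity P q) (hX : JointlyMeasurable X)
    (hY : JointlyMeasurable Y) : Measurable (covDensity q X Y) := by
  unfold covDensity dotProduct Matrix.mulVec dotProduct
  exact Finset.measurable_fun_sum _ fun a _ => (hX a).mul (Finset.measurable_fun_sum _ fun b _ =>
    (hq.progressive a b).measurable_uncurry.mul (hY b))

theorem IsQVDensity.covDensity_nonneg (hq : IsQVDensity P q) (X : I → PathSpace d → Vec d)
    (p : I × PathSpace d) : 0 ≤ covDensity q X X p := by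
  have := (hq.posSemidef p.1 p.2).dotProduct_mulVec_nonneg (X p.1 p.2)
  simpa [covDensity] using this

theorem enorm_sqrt_sq {x : ℝ} (hx : 0 ≤ x) : ‖√x‖ₑ ^ 2 = ENNReal.ofReal x := by
  rw [Real.enorm_of_nonneg (Real.sqrt_nonneg x), ← ENNReal.ofReal_pow (Real.sqrt_nonneg x),
    Real.sq_sqrt hx]

theorem IsQVDensity.energyNorm_sq (hq : IsQVDensity P q) (X : I → PathSpace d → Vec d) :
    energyNorm P q X ^ 2 = ∫⁻ p, ENNReal.ofReal (covDensity q X X p) ∂(volume.prod P) := by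
  rw [energyNorm, eLpNorm_two_sq]
  exact lintegral_congr fun p => enorm_sqrt_sq (hq.covDensity_nonneg X p)

theorem IsQVDensity.energyNorm_sq_eq_lintegral [SFinite P] (hq : IsQVDensity P q)
    (hX : JointlyMeasurable X) :
    energyNorm P q X ^ 2 = ∫⁻ ω, (∫⁻ t : I,
      ENNReal.ofReal (X t ω ⬝ᵥ (q t ω).mulVec (X t ω))) ∂P := by
  rw [hq.energyNorm_sq, lintegral_prod_symm _
    (hq.measurable_covDensity hX hX).ennreal_ofReal.aemeasurable]
  rfl

/-- The pointwise triangle inequality for the seminorm of `q`, followed by Minkowski's inequality in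
`L²`. -/
theorem IsQVDensity.energyNorm_add_le (hq : IsQVDensity P q) (hX : JointlyMeasurable X)
    (hY : JointlyMeasurable Y) :
    energyNorm P q (fun t ω => X t ω + Y t ω) ≤ energyNorm P q X + energyNorm P q Y := by
  unfold energyNorm
  refine (eLpNorm_mono_real fun p => ?_).trans (eLpNorm_add_le
    (hq.measurable_covDensity hX hX).sqrt.aestronglyMeasurable
    (hq.measurable_covDensity hY hY).sqrt.aestronglyMeasurable one_le_two)
  rw [Real.norm_of_nonneg (Real.sqrt_nonneg _)]
  exact (hq.posSemidef p.1 p.2).sqrt_add_dotProduct_le _ _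

theorem energyNorm_sub_comm (X Y : I → PathSpace d → Vec d) :
    energyNorm P q (fun t ω => X t ω - Y t ω) = energyNorm P q (fun t ω => Y t ω - X t ω) := by
  unfold energyNorm
  congr 1
  ext p
  have : (X p.1 p.2 - Y p.1 p.2).ofLp = -(Y p.1 p.2 - X p.1 p.2).ofLp := by
    rw [← WithLp.ofLp_neg, neg_sub]
  simp only [covDensity, this, Matrix.mulVec_neg, neg_dotProduct, dotProduct_neg, neg_neg]

theorem IsQVDensity.energyNorm_sub_le (hq : IsQVDensity P q) (hX : JointlyMeasurable X)
    (hY : JointlyMeasurable Y) (hZ : JointlyMeasurable Z) :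
    energyNorm P q (fun t ω => X t ω - Z t ω) ≤
      energyNorm P q (fun t ω => X t ω - Y t ω) + energyNorm P q (fun t ω => Y t ω - Z t ω) := by
  have := hq.energyNorm_add_le (hX.sub hY) (hY.sub hZ)
  simpa only [sub_add_sub_cancel] using this

theorem IsQVDensity.energyNorm_le (hq : IsQVDensity P q) (hX : JointlyMeasurable X)
    (hY : JointlyMeasurable Y) :
    energyNorm P q X ≤ energyNorm P q (fun t ω => X t ω - Y t ω) + energyNorm P q Y := by
  have := hq.energyNorm_add_le (hX.sub hY) hY
  simpa only [sub_add_cancel] using this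

theorem IsQVDensity.covDensity_sub_self (hq : IsQVDensity P q) (X Y : I → PathSpace d → Vec d)
    (p : I × PathSpace d) :
    covDensity q (fun t ω => X t ω - Y t ω) (fun t ω => X t ω - Y t ω) p
      = covDensity q X X p - 2 * covDensity q X Y p + covDensity q Y Y p := by
  have hs : covDensity q Y X p = covDensity q X Y p := by
    have hT : (q p.1 p.2).transpose = q p.1 p.2 := by
      ext i j; exact hq.symm p.1 p.2 j i
    unfold covDensity
    rw [Matrix.dotProduct_mulVec, dotProduct_comm, ← Matrix.mulVec_transpose, hT]
  have : ∀ U V W : I → PathSpace d → Vec d,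
      covDensity q (fun t ω => U t ω - V t ω) W p = covDensity q U W p - covDensity q V W p := by
    intro U V W
    simp only [covDensity, WithLp.ofLp_sub, sub_dotProduct]
  have this' : ∀ U V W : I → PathSpace d → Vec d,
      covDensity q W (fun t ω => U t ω - V t ω) p = covDensity q W U p - covDensity q W V p := by
    intro U V W
    simp only [covDensity, WithLp.ofLp_sub, Matrix.mulVec_sub, dotProduct_sub]
  rw [this, this', this', hs]
  ring

namespace SimpleIntegrand

variable {K L : SimpleIntegrand d}

theorem lintegral_enorm_sq {Ω : Type*} {m : MeasurableSpace Ω} {μ : Measure Ω} {f : Ω → ℝ}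
    (hf : MemLp f 2 μ) : ∫⁻ ω, ‖f ω‖ₑ ^ 2 ∂μ = ENNReal.ofReal (∫ ω, f ω * f ω ∂μ) := by
  rw [ofReal_integral_eq_lintegral_ofReal (memLp_two_mul_integrable hf hf)
    (Eventually.of_forall fun ω => mul_self_nonneg _)]
  refine lintegral_congr fun ω => ?_
  rw [← abs_mul_abs_self, ← sq, ENNReal.ofReal_pow (abs_nonneg _), Real.enorm_eq_ofReal_abs]

/-- The **Itô isometry** for bounded simple integrands. -/
theorem IsBounded.eLpNorm_integral_one [IsFiniteMeasure P]
    (hB : Martingale (fun t => B (d := d) t) (canonFiltration d) P) (hq : IsQVDensity P q)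
    (hK : K.IsBounded) : eLpNorm (K.integral 1) 2 P = energyNorm P q K.process := by
  have h : eLpNorm (K.integral 1) 2 P ^ 2 = energyNorm P q K.process ^ 2 := by
    rw [eLpNorm_two_sq, lintegral_enorm_sq ((hK.isL2Martingale_integral hB hq).memLp 1),
      hK.integral_mul_integral hB hq hK, hq.energyNorm_sq,
      ofReal_integral_eq_lintegral_ofReal (hK.integrable_covDensity hq hK)
        (Eventually.of_forall fun p => hq.covDensity_nonneg _ p)]
  exact (ENNReal.pow_right_strictMono two_ne_zero).injective h

/-- `K` and `L` may live on different partitions. Expanding the square and applying the polarized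
isometry three times avoids a common refinement. -/
theorem IsBounded.lintegral_integral_sub_sq [IsFiniteMeasure P]
    (hB : Martingale (fun t => B (d := d) t) (canonFiltration d) P) (hq : IsQVDensity P q)
    (hK : K.IsBounded) (hL : L.IsBounded) :
    ∫⁻ ω, ‖K.integral 1 ω - L.integral 1 ω‖ₑ ^ 2 ∂P
      = energyNorm P q (fun t ω => K.process t ω - L.process t ω) ^ 2 := by
  have mK := (hK.isL2Martingale_integral hB hq).memLp 1
  have mL := (hL.isL2Martingale_integral hB hq).memLp 1
  have iKK := hK.integrable_covDensity hq hK
  have iKL := hK.integrable_covDensity hq hL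
  have iLL := hL.integrable_covDensity hq hL
  have e : ∀ p, covDensity q (fun t ω => K.process t ω - L.process t ω)
      (fun t ω => K.process t ω - L.process t ω) p = covDensity q K.process K.process p
        - 2 * covDensity q K.process L.process p + covDensity q L.process L.process p :=
    hq.covDensity_sub_self _ _
  have i2 : Integrable (fun p => covDensity q K.process K.process p
      - 2 * covDensity q K.process L.process p) (volume.prod P) := iKK.sub (iKL.const_mul 2)
  rw [lintegral_enorm_sq (f := fun ω => K.integral 1 ω - L.integral 1 ω) (mK.sub mL),
    hq.energyNorm_sq, ← ofReal_integral_eq_lintegral_ofReal ((i2.add iLL).congr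
      (Eventually.of_forall fun p => (e p).symm))
      (Eventually.of_forall fun p => hq.covDensity_nonneg _ p)]
  congr 1
  simp_rw [e]
  rw [integral_add i2 iLL, integral_sub iKK (iKL.const_mul 2), integral_const_mul,
    ← hK.integral_mul_integral hB hq hK, ← hK.integral_mul_integral hB hq hL,
    ← hL.integral_mul_integral hB hq hL]
  have jKK := memLp_two_mul_integrable mK mK
  have jKL := memLp_two_mul_integrable mK mL
  have jLL := memLp_two_mul_integrable mL mL
  have j2 : Integrable (fun ω => K.integral 1 ω * K.integral 1 ω
      - 2 * (K.integral 1 ω * L.integral 1 ω)) P := jKK.sub (jKL.const_mul 2)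
  rw [← integral_const_mul, ← integral_sub jKK (jKL.const_mul 2), ← integral_add j2 jLL]
  congr 1; ext ω; ring

end SimpleIntegrand

end Energy

/-! ### Uniform norms of paths -/

section PathSup

variable {Ω : Type*} {m : MeasurableSpace Ω} {μ : Measure Ω}

/-- The supremum of the absolute value of a path. -/
def pathSup (X : I → Ω → ℝ) (ω : Ω) : ℝ≥0∞ := ⨆ t, ‖X t ω‖ₑ

theorem enorm_le_pathSup (X : I → Ω → ℝ) (t : I) (ω : Ω) : ‖X t ω‖ₑ ≤ pathSup X ω :=
  le_iSup (fun t => ‖X t ω‖ₑ) t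

theorem pathSup_sq (X : I → Ω → ℝ) (ω : Ω) : pathSup X ω ^ 2 = ⨆ t, ‖X t ω‖ₑ ^ 2 :=
  Monotone.map_iSup_of_continuousAt (f := fun x : ℝ≥0∞ => x ^ 2)
    (ENNReal.continuous_pow 2).continuousAt (fun _ _ h => by dsimp only; gcongr) (by simp)

/-- Continuity of every path reduces the supremum to a countable dense set of times. -/
theorem measurable_pathSup {X : I → Ω → ℝ} (hX : ∀ t, Measurable (X t))
    (hc : ∀ ω, Continuous fun t => X t ω) : Measurable (pathSup X) := by
  have : pathSup X = fun ω => ⨆ n : ℕ, ‖X (TopologicalSpace.denseSeq I n) ω‖ₑ := by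
    ext ω
    refine le_antisymm (iSup_le fun t => ?_) (iSup_le fun n => enorm_le_pathSup X _ ω)
    have hcl : IsClosed {t : I | ‖X t ω‖ₑ ≤ ⨆ n : ℕ, ‖X (TopologicalSpace.denseSeq I n) ω‖ₑ} :=
      isClosed_le (hc ω).enorm continuous_const
    have := (TopologicalSpace.denseRange_denseSeq I).closure_range ▸
      closure_minimal (s := range (TopologicalSpace.denseSeq I)) (fun _ ⟨n, hn⟩ => by
        rw [← hn]; exact le_iSup (fun n => ‖X (TopologicalSpace.denseSeq I n) ω‖ₑ) n) hcl
    exact this (mem_univ t)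
  rw [this]
  exact Measurable.iSup fun n => (hX _).enorm

/-- **Fatou's lemma** for the norm of the supremum of the paths. -/
theorem eLpNorm_pathSup_le_of_tendsto {X : ℕ → I → Ω → ℝ} {Y : I → Ω → ℝ}
    (hX : ∀ n, AEMeasurable (pathSup (X n)) μ)
    (hY : ∀ᵐ ω ∂μ, ∀ t, Tendsto (fun n => X n t ω) atTop (𝓝 (Y t ω))) {c : ℕ → ℝ≥0∞} {C : ℝ≥0∞}
    (hc : ∀ n, eLpNorm (pathSup (X n)) 2 μ ≤ c n) (hC : Tendsto c atTop (𝓝 C)) :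
    eLpNorm (pathSup Y) 2 μ ≤ C := by
  rw [← ENNReal.pow_le_pow_left_iff two_ne_zero, eLpNorm_two_sq]
  simp only [enorm_eq_self]
  have h1 : ∫⁻ ω, pathSup Y ω ^ 2 ∂μ ≤ ∫⁻ ω, liminf (fun n => pathSup (X n) ω ^ 2) atTop ∂μ := by
    refine lintegral_mono_ae ?_
    filter_upwards [hY] with ω hω
    rw [pathSup_sq]
    refine iSup_le fun t => ?_
    have h2 : Tendsto (fun n => ‖X n t ω‖ₑ ^ 2) atTop (𝓝 (‖Y t ω‖ₑ ^ 2)) :=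
      ((ENNReal.continuous_pow 2).comp continuous_enorm).continuousAt.tendsto.comp (hω t)
    rw [← h2.liminf_eq]
    refine liminf_le_liminf (Eventually.of_forall fun n => ?_)
    gcongr
    exact enorm_le_pathSup _ t ω
  refine h1.trans ((lintegral_liminf_le' fun n => (hX n).pow_const 2).trans ?_)
  have h3 : Tendsto (fun n => c n ^ 2) atTop (𝓝 (C ^ 2)) := ENNReal.Tendsto.pow hC
  rw [← h3.liminf_eq]
  refine liminf_le_liminf (Eventually.of_forall fun n => ?_)
  have := eLpNorm_two_sq (μ := μ) (pathSup (X n))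
  simp only [enorm_eq_self] at this
  rw [← this]
  gcongr
  exact hc n

end PathSup

/-! ### Truncation of simple integrands -/

section Truncation

variable {d : ℕ} {P : Measure (PathSpace d)} {q : I → PathSpace d → Matrix (Fin d) (Fin d) ℝ}
  {K L : SimpleIntegrand d}

namespace SimpleIntegrand

/-- The simple integrand whose values are set to zero where their norm exceeds `N`. -/
def trunc (K : SimpleIntegrand d) (N : ℕ) : SimpleIntegrand d :=
  { K with
    val := fun i => {ω | ‖K.val i ω‖ ≤ N}.indicator (K.val i)
    val_measurable := fun i => (K.val_measurable i).indicator
      ((measurable_norm.comp (K.val_measurable i)) measurableSet_Iic) }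

/-- The zero integrand. -/
def zero (d : ℕ) : SimpleIntegrand d where
  n := 1
  time := ![0, 1]
  time_mono := by
    rw [Fin.monotone_iff_le_succ]
    intro i
    fin_cases i
    exact unitInterval.nonneg'
  time_zero := rfl
  time_last := rfl
  val := fun _ _ => 0
  val_measurable := fun _ => measurable_const

@[simp] theorem zero_process (s : I) (ω : PathSpace d) : (zero d).process s ω = 0 := by
  simp [process, zero]

@[simp] theorem zero_integral (s : I) (ω : PathSpace d) : (zero d).integral s ω = 0 := by
  simp [integral, zero]

theorem trunc_isBounded (K : SimpleIntegrand d) (N : ℕ) : (K.trunc N).IsBounded := by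
  refine ⟨N, fun i ω => ?_⟩
  simp only [trunc, indicator]
  split_ifs with h
  · exact h
  · simp

theorem trunc_val_eventually (K : SimpleIntegrand d) (ω : PathSpace d) :
    ∀ᶠ N in atTop, ∀ i : Fin K.n, (K.trunc N).val i ω = K.val i ω := by
  rw [eventually_all]
  intro i
  filter_upwards [tendsto_natCast_atTop_atTop.eventually_ge_atTop ‖K.val i ω‖] with N hN
  exact indicator_of_mem (s := {ω | ‖K.val i ω‖ ≤ N}) hN (K.val i)

theorem trunc_process_eventually (K : SimpleIntegrand d) (ω : PathSpace d) :
    ∀ᶠ N in atTop, ∀ s, (K.trunc N).process s ω = K.process s ω := by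
  filter_upwards [K.trunc_val_eventually ω] with N hN s
  exact Finset.sum_congr rfl fun i _ => by rw [hN i]; rfl

theorem trunc_integral_eventually (K : SimpleIntegrand d) (ω : PathSpace d) :
    ∀ᶠ N in atTop, ∀ s, (K.trunc N).integral s ω = K.integral s ω := by
  filter_upwards [K.trunc_val_eventually ω] with N hN s
  exact Finset.sum_congr rfl fun i _ => by rw [hN i]; rfl

/-- At each time a simple integrand takes one of its values, on all paths at once. -/
theorem process_eq_val {s : I} {i : Fin K.n} (hs : s ∈ Ico (K.time i.castSucc) (K.time i.succ))
    (ω : PathSpace d) : K.process s ω = K.val i ω := by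
  rw [process, Finset.sum_eq_single i]
  · exact indicator_of_mem hs _
  · intro j _ hji
    refine indicator_of_notMem (fun hj => ?_) _
    rcases lt_or_gt_of_ne hji with h | h
    · have : K.time j.succ ≤ K.time i.castSucc := K.time_mono (by
        rw [Fin.le_def]; simpa using h)
      exact absurd (hj.2.trans_le this) (not_lt.mpr hs.1)
    · have : K.time i.succ ≤ K.time j.castSucc := K.time_mono (by
        rw [Fin.le_def]; simpa using h)
      exact absurd (hs.2.trans_le this) (not_lt.mpr hj.1)
  · simp

theorem trunc_process (N : ℕ) (s : I) (ω : PathSpace d) :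
    (K.trunc N).process s ω = K.process s ω ∨ (K.trunc N).process s ω = 0 := by
  by_cases h : ∃ i : Fin K.n, s ∈ Ico (K.time i.castSucc) (K.time i.succ)
  · obtain ⟨i, hi⟩ := h
    rw [process_eq_val hi, process_eq_val (K := K.trunc N) (i := i) hi]
    simp only [trunc, indicator]
    split_ifs
    · exact Or.inl rfl
    · exact Or.inr rfl
  · right
    exact Finset.sum_eq_zero fun i _ => indicator_of_notMem (fun hi => h ⟨i, hi⟩) _

/-- Truncation keeps or kills the whole vector, so the density of the error is either `0` or that of
`K`, and dominated convergence applies. This carries estimates from bounded simple integrands to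
those of finite energy. -/
theorem tendsto_energyNorm_trunc (hq : IsQVDensity P q) (hK : energyNorm P q K.process ≠ ∞) :
    Tendsto (fun N => energyNorm P q fun t ω => (K.trunc N).process t ω - K.process t ω)
      atTop (𝓝 0) := by
  refine tendsto_zero_of_sq_tendsto_zero ?_
  simp_rw [hq.energyNorm_sq]
  have h0 : (0 : ℝ≥0∞) = ∫⁻ _, 0 ∂((volume : Measure I).prod P) := by simp
  rw [h0]
  refine tendsto_lintegral_of_dominated_convergence
    (fun p => ENNReal.ofReal (covDensity q K.process K.process p)) (fun N => ?_) (fun N => ?_)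
    ?_ ?_
  · have := (K.trunc N).jointlyMeasurable.sub K.jointlyMeasurable
    exact (hq.measurable_covDensity this this).ennreal_ofReal
  · refine Eventually.of_forall fun p => ENNReal.ofReal_le_ofReal ?_
    rcases trunc_process (K := K) N p.1 p.2 with h | h
    · simpa [covDensity, h] using hq.covDensity_nonneg K.process p
    · simp [covDensity, h, Matrix.mulVec_neg]
  · rw [← hq.energyNorm_sq]
    exact ENNReal.pow_ne_top hK
  · refine Eventually.of_forall fun p => tendsto_const_nhds.congr' ?_
    filter_upwards [K.trunc_process_eventually p.2] with N hN
    simp [covDensity, hN]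

theorem measurable_pathSup_integral_sub (K L : SimpleIntegrand d) :
    Measurable (pathSup fun t ω => K.integral t ω - L.integral t ω) :=
  measurable_pathSup (fun t => (measurable_integral t).sub (measurable_integral t))
    fun ω => (continuous_integral ω).sub (continuous_integral ω)

theorem IsBounded.eLpNorm_pathSup_integral_sub_le [IsFiniteMeasure P]
    (hB : Martingale (fun t => B (d := d) t) (canonFiltration d) P) (hq : IsQVDensity P q)
    (hK : K.IsBounded) (hL : L.IsBounded) :
    eLpNorm (pathSup fun t ω => K.integral t ω - L.integral t ω) 2 P
      ≤ 2 * energyNorm P q fun t ω => K.process t ω - L.process t ω := by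
  rw [← ENNReal.pow_le_pow_left_iff two_ne_zero, eLpNorm_two_sq, mul_pow,
    ← hK.lintegral_integral_sub_sq hB hq hL]
  simp only [enorm_eq_self, pathSup_sq]
  refine (((hK.isL2Martingale_integral hB hq).sub
    (hL.isL2Martingale_integral hB hq)).lintegral_iSup_sq_le (Eventually.of_forall fun ω =>
      (continuous_integral ω).sub (continuous_integral ω))).trans_eq ?_
  norm_num

/-- **Doob's inequality** for the difference of two simple integrals of finite energy. -/
theorem eLpNorm_pathSup_integral_sub_le [IsFiniteMeasure P]
    (hB : Martingale (fun t => B (d := d) t) (canonFiltration d) P) (hq : IsQVDensity P q)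
    (hK : energyNorm P q K.process ≠ ∞) (hL : energyNorm P q L.process ≠ ∞) :
    eLpNorm (pathSup fun t ω => K.integral t ω - L.integral t ω) 2 P
      ≤ 2 * energyNorm P q fun t ω => K.process t ω - L.process t ω := by
  refine eLpNorm_pathSup_le_of_tendsto
    (X := fun N t ω => (K.trunc N).integral t ω - (L.trunc N).integral t ω)
    (c := fun N => 2 * (energyNorm P q (fun t ω => (K.trunc N).process t ω - K.process t ω)
      + (energyNorm P q (fun t ω => K.process t ω - L.process t ω)
        + energyNorm P q (fun t ω => (L.trunc N).process t ω - L.process t ω))))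
    (fun N => (measurable_pathSup_integral_sub _ _).aemeasurable)
    (Eventually.of_forall fun ω t => ?_) (fun N => ?_) ?_
  · refine tendsto_const_nhds.congr' ?_
    filter_upwards [K.trunc_integral_eventually ω, L.trunc_integral_eventually ω] with N h1 h2
    rw [h1, h2]
  · refine ((K.trunc_isBounded N).eLpNorm_pathSup_integral_sub_le hB hq
      (L.trunc_isBounded N)).trans ?_
    gcongr
    refine (hq.energyNorm_sub_le (Y := K.process) (K.trunc N).jointlyMeasurable
      K.jointlyMeasurable (L.trunc N).jointlyMeasurable).trans ?_
    gcongr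
    rw [energyNorm_sub_comm (L.trunc N).process]
    exact hq.energyNorm_sub_le K.jointlyMeasurable L.jointlyMeasurable
      (L.trunc N).jointlyMeasurable
  · have h := ENNReal.Tendsto.const_mul (a := 2) ((tendsto_energyNorm_trunc hq hK).add
      ((tendsto_const_nhds (x := energyNorm P q (fun t ω => K.process t ω - L.process t ω))).add
        (tendsto_energyNorm_trunc hq hL))) (Or.inr ENNReal.ofNat_ne_top)
    simpa only [zero_add, add_zero] using h

theorem eLpNorm_pathSup_integral_le [IsFiniteMeasure P]
    (hB : Martingale (fun t => B (d := d) t) (canonFiltration d) P) (hq : IsQVDensity P q)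
    (hK : energyNorm P q K.process ≠ ∞) :
    eLpNorm (pathSup K.integral) 2 P ≤ 2 * energyNorm P q K.process := by
  have h0 : energyNorm P q (zero d).process ≠ ∞ := by
    simp [energyNorm, covDensity]
  have h := eLpNorm_pathSup_integral_sub_le hB hq hK h0
  simpa only [zero_integral, zero_process, sub_zero] using h

end SimpleIntegrand

end Truncation

/-! ### The limit of simple integrals under one measure -/

/-- The pointwise limit of the integrals of a sequence of simple integrands. -/
def limitIntegral {d : ℕ} (L : ℕ → SimpleIntegrand d) (t : I) (ω : PathSpace d) : ℝ :=
  limUnder atTop fun j => (L j).integral t ω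

/-- Where the integrals do not converge, `limUnder` returns a fixed value. The limit is thus
measurable without discarding null sets, which would depend on `P`. -/
theorem isStronglyProgressive_limitIntegral {d : ℕ} (L : ℕ → SimpleIntegrand d) :
    IsStronglyProgressive (canonFiltration d) (limitIntegral L) := fun t =>
  @StronglyMeasurable.limUnder _ _ _ (_) _ _ _ _ _ _ _ fun j =>
    SimpleIntegrand.isStronglyProgressive_integral (K := L j) t

theorem measurable_limitIntegral {d : ℕ} (L : ℕ → SimpleIntegrand d) (t : I) :
    Measurable (limitIntegral L t) :=
  (((isStronglyProgressive_limitIntegral L).stronglyAdapted t).mono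
    ((canonFiltration d).le t)).measurable

theorem eLpNorm_le_pathSup {Ω : Type*} {m : MeasurableSpace Ω} {μ : Measure Ω} (X : I → Ω → ℝ)
    (t : I) : eLpNorm (X t) 2 μ ≤ eLpNorm (pathSup X) 2 μ :=
  eLpNorm_mono_enorm fun ω => enorm_le_pathSup X t ω

section Limit

variable {d : ℕ} {P : Measure (PathSpace d)} {q : I → PathSpace d → Matrix (Fin d) (Fin d) ℝ}
  {H : I → PathSpace d → Vec d} {L : ℕ → SimpleIntegrand d}

/-- `L` approximates `H` geometrically fast in energy. -/
structure IsFastApprox (P : Measure (PathSpace d))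
    (q : I → PathSpace d → Matrix (Fin d) (Fin d) ℝ) (H : I → PathSpace d → Vec d)
    (L : ℕ → SimpleIntegrand d) : Prop where
  martingale : Martingale (fun t => B (d := d) t) (canonFiltration d) P
  isQVDensity : IsQVDensity P q
  measurable : JointlyMeasurable H
  energy_ne_top : energyNorm P q H ≠ ∞
  le : ∀ j, energyNorm P q (fun t ω => (L j).process t ω - H t ω) ≤ 2⁻¹ ^ j

namespace IsFastApprox

variable (h : IsFastApprox P q H L)
include h

theorem energyNorm_ne_top (j : ℕ) : energyNorm P q (L j).process ≠ ∞ :=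
  ne_top_of_le_ne_top (ENNReal.add_ne_top.mpr
    ⟨ne_top_of_le_ne_top (by simp) (h.le j), h.energy_ne_top⟩)
    (h.isQVDensity.energyNorm_le (L j).jointlyMeasurable h.measurable)

end IsFastApprox

end Limit

section Limit

variable {d : ℕ} {P : Measure (PathSpace d)} {q : I → PathSpace d → Matrix (Fin d) (Fin d) ℝ}
  {H : I → PathSpace d → Vec d} {L : ℕ → SimpleIntegrand d}

namespace IsFastApprox

theorem energyNorm_sub_le (h : IsFastApprox P q H L) (j l : ℕ) :
    energyNorm P q (fun t ω => (L j).process t ω - (L l).process t ω) ≤ 2⁻¹ ^ j + 2⁻¹ ^ l := by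
  refine (h.isQVDensity.energyNorm_sub_le (Y := H) (L j).jointlyMeasurable h.measurable
    (L l).jointlyMeasurable).trans (add_le_add (h.le j) ?_)
  rw [energyNorm_sub_comm]
  exact h.le l

theorem eLpNorm_pathSup_sub_le [IsFiniteMeasure P] (h : IsFastApprox P q H L) (j l : ℕ) :
    eLpNorm (pathSup fun t ω => (L j).integral t ω - (L l).integral t ω) 2 P
      ≤ 2 * (2⁻¹ ^ j + 2⁻¹ ^ l) := by
  refine (SimpleIntegrand.eLpNorm_pathSup_integral_sub_le h.martingale h.isQVDensity
    (h.energyNorm_ne_top j) (h.energyNorm_ne_top l)).trans ?_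
  gcongr
  exact h.energyNorm_sub_le j l

/-- By Doob, consecutive integrals differ in uniform norm by at most `4 * 2⁻¹ ^ j` in `L²`, hence in
`L¹`. The sum therefore has finite expectation. -/
theorem ae_tsum_pathSup_ne_top [IsProbabilityMeasure P] (h : IsFastApprox P q H L) :
    ∀ᵐ ω ∂P, ∑' j, pathSup (fun t ω => (L j).integral t ω - (L (j + 1)).integral t ω) ω ≠ ∞ := by
  have hm := fun j => SimpleIntegrand.measurable_pathSup_integral_sub (L j) (L (j + 1))
  have h1 : ∫⁻ ω, ∑' j, pathSup (fun t ω => (L j).integral t ω - (L (j + 1)).integral t ω) ω ∂P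
      ≠ ∞ := by
    rw [lintegral_tsum fun j => (hm j).aemeasurable]
    refine ne_top_of_le_ne_top (b := ∑' j : ℕ, 4 * (2⁻¹ : ℝ≥0∞) ^ j) ?_
      (ENNReal.tsum_le_tsum fun j => ?_)
    · rw [ENNReal.tsum_mul_left, ENNReal.tsum_geometric, ENNReal.one_sub_inv_two, inv_inv]
      exact ENNReal.mul_ne_top ENNReal.ofNat_ne_top ENNReal.ofNat_ne_top
    · have h2 := (eLpNorm_le_eLpNorm_of_exponent_le (p := 1) (q := 2) one_le_two
        (hm j).aestronglyMeasurable (μ := P)).trans (h.eLpNorm_pathSup_sub_le j (j + 1))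
      rw [eLpNorm_one_eq_lintegral_enorm] at h2
      simp only [enorm_eq_self] at h2
      refine h2.trans ?_
      have h3 : (2⁻¹ : ℝ≥0∞) ^ (j + 1) ≤ 2⁻¹ ^ j :=
        pow_le_pow_right_of_le_one' (ENNReal.inv_le_one.mpr one_le_two) j.le_succ
      calc 2 * ((2⁻¹ : ℝ≥0∞) ^ j + 2⁻¹ ^ (j + 1)) ≤ 2 * (2⁻¹ ^ j + 2⁻¹ ^ j) := by gcongr
        _ = 4 * 2⁻¹ ^ j := by ring
  exact (ae_lt_top' (AEMeasurable.tsum fun j => (hm j).aemeasurable) h1).mono fun ω => ne_of_lt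

/-- Summable uniform distances make the paths converge uniformly, and a uniform limit of continuous
paths is continuous. -/
theorem ae_tendsto_and_continuous [IsProbabilityMeasure P] (h : IsFastApprox P q H L) :
    ∀ᵐ ω ∂P, (∀ t, Tendsto (fun j => (L j).integral t ω) atTop (𝓝 (limitIntegral L t ω))) ∧
      Continuous fun t => limitIntegral L t ω := by
  filter_upwards [h.ae_tsum_pathSup_ne_top] with ω hω
  set S : ℕ → ℝ≥0∞ :=
    fun j => pathSup (fun t ω => (L j).integral t ω - (L (j + 1)).integral t ω) ω with hS
  have hd : ∀ t j, edist ((L j).integral t ω) ((L (j + 1)).integral t ω) ≤ S j := fun t j => by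
    rw [edist_eq_enorm_sub]
    exact enorm_le_pathSup (fun t ω => (L j).integral t ω - (L (j + 1)).integral t ω) t ω
  have ht : ∀ t, Tendsto (fun j => (L j).integral t ω) atTop (𝓝 (limitIntegral L t ω)) :=
    fun t => (cauchySeq_of_edist_le_of_tsum_ne_top S (hd t) hω).tendsto_limUnder
  refine ⟨ht, ?_⟩
  have hu : TendstoUniformly (fun j t => (L j).integral t ω) (fun t => limitIntegral L t ω)
      atTop := by
    rw [EMetric.tendstoUniformly_iff]
    intro ε hε
    filter_upwards [(ENNReal.tendsto_sum_nat_add S hω).eventually_lt_const hε] with j hj t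
    rw [edist_comm]
    refine lt_of_le_of_lt (edist_le_tsum_of_edist_le_of_tendsto S (hd t) (ht t) j) ?_
    simpa only [add_comm] using hj
  exact hu.continuous (Frequently.of_forall fun j => SimpleIntegrand.continuous_integral ω)

theorem eLpNorm_pathSup_sub_limit_le [IsProbabilityMeasure P] (h : IsFastApprox P q H L) (j : ℕ) :
    eLpNorm (pathSup fun t ω => (L j).integral t ω - limitIntegral L t ω) 2 P
      ≤ 2 * 2⁻¹ ^ j := by
  refine eLpNorm_pathSup_le_of_tendsto
    (X := fun l t ω => (L j).integral t ω - (L l).integral t ω)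
    (fun l => (SimpleIntegrand.measurable_pathSup_integral_sub _ _).aemeasurable) ?_
    (fun l => h.eLpNorm_pathSup_sub_le j l) ?_
  · filter_upwards [h.ae_tendsto_and_continuous] with ω hω t
    exact tendsto_const_nhds.sub (hω.1 t)
  · have h2 : Tendsto (fun l : ℕ => (2⁻¹ : ℝ≥0∞) ^ l) atTop (𝓝 0) :=
      ENNReal.tendsto_pow_atTop_nhds_zero_of_lt_one ENNReal.one_half_lt_one
    simpa using ENNReal.Tendsto.const_mul (a := 2)
      ((tendsto_const_nhds (x := (2⁻¹ : ℝ≥0∞) ^ j)).add h2) (Or.inr ENNReal.ofNat_ne_top)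

/-- **Doob's inequality** for the limit. -/
theorem eLpNorm_pathSup_limit_le [IsProbabilityMeasure P] (h : IsFastApprox P q H L) :
    eLpNorm (pathSup (limitIntegral L)) 2 P ≤ 2 * energyNorm P q H := by
  refine eLpNorm_pathSup_le_of_tendsto (X := fun l => (L l).integral)
    (c := fun l => 2 * (2⁻¹ ^ l + energyNorm P q H))
    (fun l => (measurable_pathSup SimpleIntegrand.measurable_integral
      SimpleIntegrand.continuous_integral).aemeasurable) ?_ (fun l => ?_) ?_
  · filter_upwards [h.ae_tendsto_and_continuous] with ω hω t
    exact hω.1 t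
  · refine (SimpleIntegrand.eLpNorm_pathSup_integral_le h.martingale h.isQVDensity
      (h.energyNorm_ne_top l)).trans ?_
    gcongr
    refine (h.isQVDensity.energyNorm_le (L l).jointlyMeasurable h.measurable).trans ?_
    gcongr
    exact h.le l
  · have h2 : Tendsto (fun l : ℕ => (2⁻¹ : ℝ≥0∞) ^ l) atTop (𝓝 0) :=
      ENNReal.tendsto_pow_atTop_nhds_zero_of_lt_one ENNReal.one_half_lt_one
    simpa using ENNReal.Tendsto.const_mul (a := 2)
      (h2.add (tendsto_const_nhds (x := energyNorm P q H))) (Or.inr ENNReal.ofNat_ne_top)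

/-- The limit is also a limit of integrals of bounded simple integrands. -/
theorem exists_bounded_approx [IsProbabilityMeasure P] (h : IsFastApprox P q H L) :
    ∃ G : ℕ → SimpleIntegrand d, (∀ j, (G j).IsBounded) ∧
      Tendsto (fun j => energyNorm P q fun t ω => (G j).process t ω - H t ω) atTop (𝓝 0) ∧
      ∀ t, Tendsto (fun j => eLpNorm (fun ω => (G j).integral t ω - limitIntegral L t ω) 2 P)
        atTop (𝓝 0) := by
  have h2 : Tendsto (fun l : ℕ => (2⁻¹ : ℝ≥0∞) ^ l) atTop (𝓝 0) :=
    ENNReal.tendsto_pow_atTop_nhds_zero_of_lt_one ENNReal.one_half_lt_one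
  have h1 : ∀ j, ∃ N, energyNorm P q
      (fun t ω => ((L j).trunc N).process t ω - (L j).process t ω) ≤ 2⁻¹ ^ j := fun j =>
    ((SimpleIntegrand.tendsto_energyNorm_trunc h.isQVDensity
      (h.energyNorm_ne_top j)).eventually_le_const (ENNReal.pow_pos (by simp) j)).exists
  -- `N j` truncates the `j`-th approximant with an energy error no larger than its own distance
  -- bound to `H`.
  choose N hN using h1
  refine ⟨fun j => (L j).trunc (N j), fun j => (L j).trunc_isBounded _, ?_, fun t => ?_⟩
  · refine tendsto_of_tendsto_of_tendsto_of_le_of_le tendsto_const_nhds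
      (h := fun j : ℕ => (2⁻¹ : ℝ≥0∞) ^ j + 2⁻¹ ^ j) (by simpa using h2.add h2)
      (fun _ => zero_le) fun j => ?_
    exact (h.isQVDensity.energyNorm_sub_le ((L j).trunc (N j)).jointlyMeasurable
      (L j).jointlyMeasurable h.measurable).trans (add_le_add (hN j) (h.le j))
  · have h3 : Tendsto (fun j : ℕ => 2 * (2⁻¹ : ℝ≥0∞) ^ j + 2 * 2⁻¹ ^ j) atTop (𝓝 0) := by
      have := ENNReal.Tendsto.const_mul (a := 2) h2 (Or.inr ENNReal.ofNat_ne_top)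
      simpa using this.add this
    refine tendsto_of_tendsto_of_tendsto_of_le_of_le tendsto_const_nhds h3
      (fun _ => zero_le) fun j => ?_
    have hfin : energyNorm P q ((L j).trunc (N j)).process ≠ ∞ :=
      ne_top_of_le_ne_top (ENNReal.add_ne_top.mpr
        ⟨ne_top_of_le_ne_top (by simp) (hN j), h.energyNorm_ne_top j⟩)
        (h.isQVDensity.energyNorm_le ((L j).trunc (N j)).jointlyMeasurable (L j).jointlyMeasurable)
    have e1 := (SimpleIntegrand.eLpNorm_pathSup_integral_sub_le h.martingale h.isQVDensity hfin
      (h.energyNorm_ne_top j)).trans (mul_le_mul_right (hN j) 2)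
    have e2 := h.eLpNorm_pathSup_sub_limit_le j
    have m1 : Measurable fun ω => ((L j).trunc (N j)).integral t ω - (L j).integral t ω :=
      (SimpleIntegrand.measurable_integral t).sub (SimpleIntegrand.measurable_integral t)
    have m2 : Measurable fun ω => (L j).integral t ω - limitIntegral L t ω :=
      (SimpleIntegrand.measurable_integral t).sub (measurable_limitIntegral L t)
    have e3 := eLpNorm_add_le (p := 2) (μ := P) m1.aestronglyMeasurable m2.aestronglyMeasurable
      one_le_two
    have e4 : ((fun ω => ((L j).trunc (N j)).integral t ω - (L j).integral t ω) +
        fun ω => (L j).integral t ω - limitIntegral L t ω)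
        = fun ω => ((L j).trunc (N j)).integral t ω - limitIntegral L t ω := by
      ext ω; simp
    rw [e4] at e3
    exact e3.trans (add_le_add ((eLpNorm_le_pathSup (fun t ω =>
      ((L j).trunc (N j)).integral t ω - (L j).integral t ω) t).trans e1)
      ((eLpNorm_le_pathSup (fun t ω => (L j).integral t ω - limitIntegral L t ω) t).trans e2))

/-- The **Itô isometry** for the limit. -/
theorem eLpNorm_limit_one [IsProbabilityMeasure P] (h : IsFastApprox P q H L) :
    eLpNorm (limitIntegral L 1) 2 P = energyNorm P q H := by
  obtain ⟨G, hGb, hGe, hGt⟩ := h.exists_bounded_approx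
  have mG : ∀ j, AEStronglyMeasurable ((G j).integral 1) P := fun j =>
    (SimpleIntegrand.measurable_integral 1).aestronglyMeasurable
  have mM : AEStronglyMeasurable (limitIntegral L 1) P :=
    (measurable_limitIntegral L 1).aestronglyMeasurable
  have iso := fun j => (hGb j).eLpNorm_integral_one h.martingale h.isQVDensity
  have tri : ∀ f g : PathSpace d → ℝ, AEStronglyMeasurable f P → AEStronglyMeasurable g P →
      eLpNorm f 2 P ≤ eLpNorm (fun ω => f ω - g ω) 2 P + eLpNorm g 2 P := by
    intro f g hf hg
    have := eLpNorm_add_le (p := 2) (hf.sub hg) hg one_le_two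
    rw [sub_add_cancel] at this
    exact this
  -- Each of the two inequalities holds up to an error that vanishes along the bounded approximants,
  -- whose isometry is exact.
  have hsum : ∀ c : ℝ≥0∞, Tendsto (fun j =>
      eLpNorm (fun ω => (G j).integral 1 ω - limitIntegral L 1 ω) 2 P
        + (energyNorm P q (fun t ω => (G j).process t ω - H t ω) + c)) atTop (𝓝 c) := by
    intro c
    simpa using (hGt 1).add (hGe.add (tendsto_const_nhds (x := c)))
  refine le_antisymm (ge_of_tendsto' (hsum _) fun j => ?_) (ge_of_tendsto' (hsum _) fun j => ?_)
  · refine (tri _ _ mM (mG j)).trans (add_le_add (le_of_eq ?_) ?_)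
    · exact eLpNorm_sub_comm _ _ _ _
    · rw [iso j]
      exact h.isQVDensity.energyNorm_le (G j).jointlyMeasurable h.measurable
  · refine (h.isQVDensity.energyNorm_le h.measurable (G j).jointlyMeasurable).trans ?_
    rw [energyNorm_sub_comm, ← iso j, add_left_comm]
    exact add_le_add le_rfl (tri _ _ (mG j) mM)

end IsFastApprox

end Limit

/-! ### Identification with the Itô integral under one measure, and uniqueness. -/

theorem lintegral_energy_eq {d : ℕ} {P : Measure (PathSpace d)} [SFinite P]
    (hq : IsQVDensity P (qvDensity P)) {X : I → PathSpace d → Vec d} (hX : JointlyMeasurable X) :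
    ∫⁻ ω, energy P X ω ∂P = energyNorm P (qvDensity P) X ^ 2 :=
  (hq.energyNorm_sq_eq_lintegral hX).symm

namespace IsFastApprox

variable {d : ℕ} {P : Measure (PathSpace d)} [IsProbabilityMeasure P]
  {H : I → PathSpace d → Vec d} {L : ℕ → SimpleIntegrand d}

theorem isItoIntegral (h : IsFastApprox P (qvDensity P) H L) :
    IsItoIntegral P H (limitIntegral L) := by
  obtain ⟨G, hGb, hGe, hGt⟩ := h.exists_bounded_approx
  refine ⟨fun t => (measurable_limitIntegral L t).aestronglyMeasurable,
    h.ae_tendsto_and_continuous.mono fun ω hω => hω.2, G, hGb, ?_, hGt⟩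
  have h2 := ENNReal.Tendsto.pow (n := 2) hGe
  rw [zero_pow two_ne_zero] at h2
  refine h2.congr fun j => ?_
  rw [lintegral_energy_eq h.isQVDensity ((G j).jointlyMeasurable.sub h.measurable)]

/-- Two bounded approximating sequences of `H` have vanishing mutual energy distance, so by Doob
their integrals share the same `L²` limit at each time. Agreement on a countable dense set of times
extends to all times by continuity. -/
theorem indistinguishable (h : IsFastApprox P (qvDensity P) H L) {N : I → PathSpace d → ℝ}
    (hN : IsItoIntegral P H N) : ∀ᵐ ω ∂P, ∀ t, N t ω = limitIntegral L t ω := by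
  obtain ⟨hNm, hNc, K, hKb, hKe, hKt⟩ := hN
  obtain ⟨G, hGb, hGe, hGt⟩ := h.exists_bounded_approx
  have hKe' : Tendsto (fun j => energyNorm P (qvDensity P)
      fun t ω => (K j).process t ω - H t ω) atTop (𝓝 0) := by
    refine tendsto_zero_of_sq_tendsto_zero (hKe.congr fun j => ?_)
    rw [lintegral_energy_eq h.isQVDensity ((K j).jointlyMeasurable.sub h.measurable)]
  have hpt : ∀ t, N t =ᵐ[P] limitIntegral L t := by
    intro t
    have mM := (measurable_limitIntegral L t).aestronglyMeasurable (μ := P)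
    have mK := fun j => (SimpleIntegrand.measurable_integral (K := K j) t).aestronglyMeasurable
      (μ := P)
    have mG := fun j => (SimpleIntegrand.measurable_integral (K := G j) t).aestronglyMeasurable
      (μ := P)
    have hz : eLpNorm (N t - limitIntegral L t) 2 P = 0 := by
      have hlim : Tendsto (fun j => eLpNorm (fun ω => (K j).integral t ω - N t ω) 2 P
          + (2 * (energyNorm P (qvDensity P) (fun t ω => (K j).process t ω - H t ω)
              + energyNorm P (qvDensity P) (fun t ω => (G j).process t ω - H t ω))
            + eLpNorm (fun ω => (G j).integral t ω - limitIntegral L t ω) 2 P)) atTop (𝓝 0) := by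
        have := (hKt t).add ((ENNReal.Tendsto.const_mul (a := 2) (hKe'.add hGe)
          (Or.inr ENNReal.ofNat_ne_top)).add (hGt t))
        simpa using this
      refine le_antisymm (ge_of_tendsto' hlim fun j => ?_) zero_le
      have e1 : N t - limitIntegral L t = (N t - (K j).integral t)
          + (((K j).integral t - (G j).integral t)
            + ((G j).integral t - limitIntegral L t)) := by abel
      rw [e1]
      refine (eLpNorm_add_le ((hNm t).sub (mK j)) (((mK j).sub (mG j)).add ((mG j).sub mM))
        one_le_two).trans (add_le_add (eLpNorm_sub_comm _ _ _ _).le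
        ((eLpNorm_add_le ((mK j).sub (mG j)) ((mG j).sub mM) one_le_two).trans
          (add_le_add ?_ le_rfl)))
      refine (eLpNorm_le_pathSup (fun t ω => (K j).integral t ω - (G j).integral t ω) t).trans
        ((SimpleIntegrand.IsBounded.eLpNorm_pathSup_integral_sub_le h.martingale h.isQVDensity
          (hKb j) (hGb j)).trans ?_)
      gcongr
      rw [energyNorm_sub_comm (G j).process]
      exact h.isQVDensity.energyNorm_sub_le (K j).jointlyMeasurable h.measurable
        (G j).jointlyMeasurable
    have h0 := (eLpNorm_eq_zero_iff ((hNm t).sub mM) two_ne_zero).mp hz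
    filter_upwards [h0] with ω hω
    exact sub_eq_zero.mp hω
  have hall : ∀ᵐ ω ∂P, ∀ n, N (TopologicalSpace.denseSeq I n) ω
      = limitIntegral L (TopologicalSpace.denseSeq I n) ω := ae_all_iff.mpr fun n => hpt _
  filter_upwards [hall, hNc, h.ae_tendsto_and_continuous] with ω h1 h2 h3 t
  refine congrFun (Continuous.ext_on (TopologicalSpace.denseRange_denseSeq I) h2 h3.2 ?_) t
  rintro _ ⟨n, rfl⟩
  exact h1 n

end IsFastApprox

/-! ### From one measure to the norms over the class. -/

/-- A continuous function exceeding its essential supremum at `1` would do so on some interval `(a,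
1]`, which has positive measure. -/
theorem apply_one_le_essSup {f : I → ℝ≥0∞} (hf : Continuous f) : f 1 ≤ essSup f volume := by
  by_contra! hlt
  have hU : {t | essSup f volume < f t} ∈ 𝓝 (1 : I) :=
    (isOpen_lt continuous_const hf).mem_nhds hlt
  obtain ⟨a, ha, hsub⟩ := exists_Ioc_subset_of_mem_nhds hU ⟨0, zero_lt_one⟩
  have h0 : volume {t | essSup f volume < f t} = 0 := by
    have := ENNReal.ae_le_essSup (μ := (volume : Measure I)) f
    rw [ae_iff] at this
    simpa only [not_le] using this
  have h1 := measure_mono_null hsub h0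
  rw [unitInterval.volume_Ioc, ENNReal.ofReal_eq_zero] at h1
  have : (a : ℝ) < (1 : I) := ha
  linarith

theorem isQVDensity_qvDensity {d : ℕ} {P : Measure (PathSpace d)}
    (h : ∃ a, IsQVDensity P a) : IsQVDensity P (qvDensity P) := by
  rw [qvDensity, dif_pos h]
  exact h.choose_spec

theorem energyNorm_le_hNorm {d : ℕ} {Pc : Set (Measure (PathSpace d))}
    {P : Measure (PathSpace d)} [SFinite P] (hP : P ∈ Pc) (hq : IsQVDensity P (qvDensity P))
    {X : I → PathSpace d → Vec d} (hX : JointlyMeasurable X) :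
    energyNorm P (qvDensity P) X ≤ hNorm Pc X := by
  have h1 : energyNorm P (qvDensity P) X = (∫⁻ ω, energy P X ω ∂P) ^ (1 / 2 : ℝ) := by
    rw [lintegral_energy_eq hq hX, ← ENNReal.rpow_natCast, ← ENNReal.rpow_mul]
    norm_num
  rw [h1]
  exact ENNReal.rpow_le_rpow (le_iSup₂_of_le P hP le_rfl) (by norm_num)

end QuasiSure

end

theorem theorem5p4 (d : ℕ) (aLow aUp : Matrix (Fin d) (Fin d) ℝ)
    (hLow : aLow.PosSemidef) (hLowUp : (aUp - aLow).PosSemidef) (hUp : aUp.PosDef)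
    (H : unitInterval → QuasiSure.PathSpace d → QuasiSure.Vec d)
    (hH : QuasiSure.MemH2 hLow.isHermitian aUp H) :
    ∃ M : unitInterval → QuasiSure.PathSpace d → ℝ,
      QuasiSure.MemS2 (QuasiSure.measureClass hLow.isHermitian aUp) M ∧
      (∀ P ∈ QuasiSure.measureClass hLow.isHermitian aUp,
        QuasiSure.IsItoIntegral P H M ∧
        ∀ N : unitInterval → QuasiSure.PathSpace d → ℝ, QuasiSure.IsItoIntegral P H N →
          ∀ᵐ ω ∂P, ∀ t, N t ω = M t ω) ∧
      QuasiSure.hNorm (QuasiSure.measureClass hLow.isHermitian aUp) H ≤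
        QuasiSure.sNorm (QuasiSure.measureClass hLow.isHermitian aUp) M ∧
      QuasiSure.sNorm (QuasiSure.measureClass hLow.isHermitian aUp) M ≤
        2 * QuasiSure.hNorm (QuasiSure.measureClass hLow.isHermitian aUp) H := by
  open QuasiSure in
  obtain ⟨K, -, hK⟩ := hH.approx
  set Pc := measureClass hLow.isHermitian aUp with hPc
  -- The index is chosen by the supremum norm and so does not depend on `P`; this is what makes a
  -- single `M` work for the whole class.
  have hfast : ∀ j : ℕ, ∃ k, hNorm Pc (fun t ω => (K k).process t ω - H t ω) ≤ 2⁻¹ ^ j :=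
    fun j => (hK.eventually_le_const (ENNReal.pow_pos (by simp) j)).exists
  choose k hk using hfast
  have hHm := hH.progressive.jointlyMeasurable
  have key : ∀ P ∈ Pc, IsProbabilityMeasure P ∧
      IsFastApprox P (qvDensity P) H (fun j => K (k j)) := by
    rintro P hP
    obtain ⟨hprob, hB, a, ha, -⟩ := id hP
    have hq := isQVDensity_qvDensity ⟨a, ha⟩
    refine ⟨hprob, hB, hq, hHm, ?_, fun j => ?_⟩
    · exact ne_top_of_le_ne_top hH.finite.ne (energyNorm_le_hNorm hP hq hHm)
    · exact (energyNorm_le_hNorm hP hq ((K (k j)).jointlyMeasurable.sub hHm)).trans (hk j)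
  set M := limitIntegral fun j => K (k j) with hM
  have hcont : ∀ P ∈ Pc, ∀ᵐ ω ∂P, Continuous fun t => M t ω := fun P hP => by
    have := (key P hP).1
    exact (key P hP).2.ae_tendsto_and_continuous.mono fun ω hω => hω.2
  have hle : sNorm Pc M ≤ 2 * hNorm Pc H := by
    -- Doob's constant `4` acts inside the square root.
    have h2 : (2 : ENNReal) = (4 : ENNReal) ^ (1 / 2 : ℝ) := by
      rw [show (4 : ENNReal) = 2 ^ (2 : ℝ) by norm_num, ← ENNReal.rpow_mul]
      norm_num
    rw [sNorm, hNorm, h2, ← ENNReal.mul_rpow_of_nonneg _ _ (by norm_num)]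
    refine ENNReal.rpow_le_rpow (iSup₂_le fun P hP => ?_) (by norm_num)
    have := (key P hP).1
    have hP' := (key P hP).2
    calc ∫⁻ ω, essSup (fun t => ‖M t ω‖ₑ ^ 2) MeasureTheory.volume ∂P
        ≤ ∫⁻ ω, pathSup M ω ^ 2 ∂P :=
          MeasureTheory.lintegral_mono fun ω => by
            rw [pathSup_sq]; exact essSup_le_iSup
      _ = MeasureTheory.eLpNorm (pathSup M) 2 P ^ 2 := by
          rw [eLpNorm_two_sq]; simp only [enorm_eq_self]
      _ ≤ (2 * energyNorm P (qvDensity P) H) ^ 2 := by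
          gcongr
          exact hP'.eLpNorm_pathSup_limit_le
      _ = 4 * ∫⁻ ω, energy P H ω ∂P := by
          rw [lintegral_energy_eq hP'.isQVDensity hHm, mul_pow]; norm_num
      _ ≤ 4 * ⨆ P ∈ Pc, ∫⁻ ω, energy P H ω ∂P := by
          gcongr
          exact le_iSup₂_of_le P hP le_rfl
  refine ⟨M, ⟨isStronglyProgressive_limitIntegral _, hcont, ?_⟩, fun P hP => ?_, ?_, hle⟩
  · exact hle.trans_lt (ENNReal.mul_lt_top ENNReal.ofNat_lt_top hH.finite)
  · have := (key P hP).1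
    exact ⟨(key P hP).2.isItoIntegral, fun N hN => (key P hP).2.indistinguishable hN⟩
  -- For each `P`, the isometry identifies the energy of `H` with the second moment of `M 1`, and
  -- continuity at time `1` bounds `|M 1|²` by the essential supremum.
  · refine ENNReal.rpow_le_rpow (iSup₂_le fun P hP => le_iSup₂_of_le P hP ?_) (by norm_num)
    have := (key P hP).1
    have hP' := (key P hP).2
    rw [lintegral_energy_eq hP'.isQVDensity hHm, ← hP'.eLpNorm_limit_one, eLpNorm_two_sq]
    refine MeasureTheory.lintegral_mono_ae ?_
    filter_upwards [hcont P hP] with ω hω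
    exact apply_one_le_essSup ((ENNReal.continuous_pow 2).comp hω.enorm)
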